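/- **Notation.** Let $I\subseteq\mathbb R_+=(0,\infty)$ be a nonempty open interval, $d$ a natural number, $(T,\mathcal A,\mu)$ a probability space. For $f,g:I\to\mathbb R$ put $\mathcal D_{f,g}(x,y)=f(x)g(y)-f(y)g(x)$. The pair $(f,g)$ is a *Chebyshev system* on $I$ if $f,g$ are continuous and $\mathcal D_{f,g}(x,y)\ne0$ for all $x\neq y$ in $I$. It belongs to $\mathcal C_3(I)$ if in addition $f,g$ are three times continuously differentiable and $W_{f,g}:=f'g-fg'$ does not vanish on $I$. Then put $$\Phi_{f,g}=\frac{f''g-fg''}{W_{f,g}},\qquad \Psi_{f,g}=-\frac{f''g'-f'g''}{W_{f,g}}.$$ Pairs $(f,g)$, $(h,k)$ are *equivalent* on an interval $J$ if there are reals $a,b,c,e$ with $ae-bc\neq0$, $f=ah+bk$ and $g=ch+ek$ on $J$. A *$d$-variable mean* on $I$ is a function $M:I^d\to I$ with $\min_i x_i\le M(\mathbf x)\le\max_i x_i$ for all $\mathbf x\in I^d$. Let $I/I=\{x/y: x,y\in I\}$ and, for $\lambda\in I/I$, $I_\lambda=I\cap\frac1\lambda I$ and $f_\lambda(x)=f(\lambda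 x)$. $M$ is *homogeneous* if $M(\lambda\mathbf x)=\lambda M(\mathbf x)$ for all $\lambda\in I/I$, $\mathbf x\in I_\lambda^d$. A *measurable family of means* is a map $m:I^d\times T\to I$ such that $m(\cdot,t)$ is a mean for each $t\in T$ and $m(\mathbf x,\cdot)$ is measurable for each $\mathbf x\in I^d$; it is *homogeneous* if every $m(\cdot,t)$ is. A function $\varphi:I^d\times T\to\mathbb R$ is of *$L^q$-type at* $\mathbf p\in I^d$ if $\varphi(\mathbf p,\cdot)$ is measurable and there are $\delta>0$ and a measurable $a\in L^q(\mu)$ such that $|\varphi(\mathbf x,t)|\le a(t)$ for all $t\in T$ and all $\mathbf x\in I^d$ with $|\mathbf x-\mathbf p|\le\delta$. The family $m$ belongs to $\mathcal C_3(I^d\times T)$ if every $m(\cdot,t)$ is three times continuously partially differentiable on $I^d$ and, at every point of $I^d$ and for all indices $i,j,l$, $\partial_i m$ is of $L^3$-type, $\partial_i\partial_j m$ is of $L^{3/2}$-type and $\partial_i\partial_j\partial_l m$ is of $L^1$-type. Write $x^{(d)}=(x,\dots,x)$ and $\partial_i^*m(\mathbf x,t)=\partial_i m(\mathbf x,t)-\int_T\partial_i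 m(\mathbf x,s)\,d\mu(s)$. For an open interval $J\subseteq I$, a Chebyshev system $(f,g)$ on $J$ and $\mathbf x\in J^d$, the *generalized Bajraktarević mean* $M_{f,g,m;\mu}(\mathbf x)$ is the unique $y\in J$ with $\int_T\mathcal D_{f,g}(m(\mathbf x,t),y)\,d\mu(t)=0$. For $(p,q)\in\mathbb C^2$ with $p+q,pq\in\mathbb R$ (so that $p,q$ are real or $p=\bar q$), define on $I$ $$(f_{p,q},g_{p,q})=\begin{cases}(x^p,\;x^q)& p,q\in\mathbb R,\ p\ne q,\\ (x^p\log x,\;x^p)& p=q\in\mathbb R,\\ (x^a\sin(b\log x),\;x^a\cos(b\log x))& p=\bar q=a+bi,\ a,b\in\mathbb R,\ b\ne0.\end{cases}$$ The *generalized Gini mean* $G_{p,q,m;\mu}$ is $M_{f_{p,q},g_{p,q},m;\mu}$; it is defined on $I^d$ if $(f_{p,q},g_{p,q})$ is a Chebyshev system on $I$ (which always holds if $p,q$ are real). **Theorem.** Let $(f,g)\in\mathcal C_3(I)$ and let $m\in\mathcal C_3(I^d\times T)$ be a homogeneous measurable family of means. Assume that there is a point $x_0\in I$ such that $$\mu\big(\{t\in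 T:\partial_1^*m(x_0^{(d)},t)=\cdots=\partial_d^*m(x_0^{(d)},t)=0\}\big)<1$$ and there are $i,j,l\in\{1,\dots,d\}$ with $$\int_T\partial_i^*m(x_0^{(d)},t)\,\partial_j^*m(x_0^{(d)},t)\,\partial_l^*m(x_0^{(d)},t)\,d\mu(t)\neq0.$$ Then the following assertions are equivalent: 1. $M_{f,g,m;\mu}$ is homogeneous; 2. $M_{f,g,m;\mu}(\mathbf x)=M_{f_\lambda,g_\lambda,m;\mu}(\mathbf x)$ for all $\lambda\in I/I$ and all $\mathbf x\in I_\lambda^d$, where the mean on the right-hand side is taken with $J=I_\lambda$; 3. for all $\lambda\in I/I$, the pairs $(f,g)$ and $(f_\lambda,g_\lambda)$ are equivalent on $I_\lambda$; 4. for all $\lambda\in I/I$ and $x\in I_\lambda$, $\Phi_{f,g}(x)=\Phi_{f_\lambda,g_\lambda}(x)$ and $\Psi_{f,g}(x)=\Psi_{f_\lambda,g_\lambda}(x)$; 5. there are $\alpha,\beta\in\mathbb R$ such that $y=f$ and $y=g$ are solutions of $y''(x)=\frac{\alpha}{x}y'(x)+\frac{\beta}{x^2}y(x)$ on $I$; 6.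 there is $(p,q)\in\mathbb C^2$ with $p+q,pq\in\mathbb R$ such that $(f_{p,q},g_{p,q})$ is a Chebyshev system on $I$ and $M_{f,g,m;\mu}=G_{p,q,m;\mu}$ on $I^d$. -/

import Mathlib

open MeasureTheory
open scoped Pointwise

namespace GenMeans

/-- The cube `I ^ d` as a set of vectors. -/
def cube (d : ℕ) (I : Set ℝ) : Set (Fin d → ℝ) := {x | ∀ i, x i ∈ I}

/-- The diagonal point `(x, …, x)`. -/
def diag (d : ℕ) (x : ℝ) : Fin d → ℝ := fun _ => x

/-- The interval `I ∩ (1/l) I`, for `l > 0`. -/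
def scaledInter (I : Set ℝ) (l : ℝ) : Set ℝ := {x | x ∈ I ∧ l * x ∈ I}

/-- The rescaled function `x ↦ f (l x)`. -/
def rescale (l : ℝ) (f : ℝ → ℝ) : ℝ → ℝ := fun x => f (l * x)

/-! ### Pairs of generating functions -/

/-- The determinant with rows `(f x, f y)` and `(g x, g y)`. -/
def chebDet (f g : ℝ → ℝ) (x y : ℝ) : ℝ := f x * g y - f y * g x

/-- `(f, g)` is a two-dimensional Chebyshev system on `I` (the class `C_0(I)`). -/
structure IsChebyshev (I : Set ℝ) (f g : ℝ → ℝ) : Prop where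
  continuousOn_left : ContinuousOn f I
  continuousOn_right : ContinuousOn g I
  det_ne_zero : ∀ x ∈ I, ∀ y ∈ I, x ≠ y → chebDet f g x y ≠ 0

/-- The Wronski determinant with rows `(f', f)` and `(g', g)`. -/
noncomputable def wronski (f g : ℝ → ℝ) (x : ℝ) : ℝ := deriv f x * g x - f x * deriv g x

/-- The class `C_n(I)`, `n ≥ 1`, of pairs of functions on an open interval `I`. -/
structure IsPairC (n : ℕ) (I : Set ℝ) (f g : ℝ → ℝ) : Prop where
  chebyshev : IsChebyshev I f g
  contDiffOn_left : ContDiffOn ℝ n f I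
  contDiffOn_right : ContDiffOn ℝ n g I
  wronski_ne_zero : ∀ x ∈ I, wronski f g x ≠ 0

/-- `(f, g)` and `(h, k)` are equivalent on `J`: each component of the first pair is a linear
combination of the second pair, with an invertible coefficient matrix. -/
def PairsEquivalent (J : Set ℝ) (f g h k : ℝ → ℝ) : Prop :=
  ∃ α β γ δ : ℝ, α * δ - β * γ ≠ 0 ∧
    ∀ x ∈ J, f x = α * h x + β * k x ∧ g x = γ * h x + δ * k x

/-- `Φ_{f,g}`. -/
noncomputable def PhiFun (f g : ℝ → ℝ) (x : ℝ) : ℝ :=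
  (deriv (deriv f) x * g x - f x * deriv (deriv g) x) / wronski f g x

/-- `Ψ_{f,g}`. -/
noncomputable def PsiFun (f g : ℝ → ℝ) (x : ℝ) : ℝ :=
  -((deriv (deriv f) x * deriv g x - deriv f x * deriv (deriv g) x) / wronski f g x)

/-! ### Means and families of means -/

/-- `M` restricts to a `d`-variable mean `I ^ d → I`. -/
def IsMean {d : ℕ} (I : Set ℝ) (M : (Fin d → ℝ) → ℝ) : Prop :=
  ∀ x ∈ cube d I, M x ∈ I ∧ (⨅ i, x i) ≤ M x ∧ M x ≤ ⨆ i, x i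

/-- Homogeneity of a function on `I ^ d`, where `I` consists of positive numbers. -/
def IsHomogeneousOn {d : ℕ} (I : Set ℝ) (M : (Fin d → ℝ) → ℝ) : Prop :=
  ∀ l ∈ I / I, ∀ x ∈ cube d (scaledInter I l), M (l • x) = l * M x

/-- `m` is a measurable family of `d`-variable means on `I`. -/
structure IsMeasurableFamily {d : ℕ} {T : Type*} [MeasurableSpace T] (I : Set ℝ)
    (m : (Fin d → ℝ) → T → ℝ) : Prop where
  isMean : ∀ t, IsMean I (fun x => m x t)
  measurable : ∀ x ∈ cube d I, Measurable (m x)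

/-- The partial derivative with respect to the `i`-th variable. -/
noncomputable def pd {d : ℕ} (i : Fin d) (F : (Fin d → ℝ) → ℝ) (x : Fin d → ℝ) : ℝ :=
  lineDeriv ℝ F x (Pi.single i 1)

/-- `φ : I ^ d × T → ℝ` is of `L^q`-type at `p`. -/
def IsLpType {d : ℕ} {T : Type*} [MeasurableSpace T] (μ : Measure T) (I : Set ℝ) (q : ENNReal)
    (φ : (Fin d → ℝ) → T → ℝ) (p : Fin d → ℝ) : Prop :=
  Measurable (φ p) ∧ ∃ δ > 0, ∃ a : T → ℝ, Measurable a ∧ MemLp a q μ ∧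
    ∀ t, ∀ x ∈ cube d I, dist x p ≤ δ → |φ x t| ≤ a t

/-- The class `C_1(I ^ d × T)`. -/
structure IsFamilyC1 {d : ℕ} {T : Type*} [MeasurableSpace T] (μ : Measure T) (I : Set ℝ)
    (m : (Fin d → ℝ) → T → ℝ) : Prop extends IsMeasurableFamily I m where
  contDiffOn_one : ∀ t, ContDiffOn ℝ 1 (fun x => m x t) (cube d I)
  pd_type_one : ∀ p ∈ cube d I, ∀ i,
    IsLpType μ I 1 (fun x t => pd i (fun y => m y t) x) p

/-- The class `C_2(I ^ d × T)`. -/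
structure IsFamilyC2 {d : ℕ} {T : Type*} [MeasurableSpace T] (μ : Measure T) (I : Set ℝ)
    (m : (Fin d → ℝ) → T → ℝ) : Prop extends IsFamilyC1 μ I m where
  contDiffOn_two : ∀ t, ContDiffOn ℝ 2 (fun x => m x t) (cube d I)
  pd_type_two : ∀ p ∈ cube d I, ∀ i,
    IsLpType μ I 2 (fun x t => pd i (fun y => m y t) x) p
  pd_pd_type_one : ∀ p ∈ cube d I, ∀ i j,
    IsLpType μ I 1 (fun x t => pd i (pd j (fun y => m y t)) x) p

/-- The class `C_3(I ^ d × T)`. -/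
structure IsFamilyC3 {d : ℕ} {T : Type*} [MeasurableSpace T] (μ : Measure T) (I : Set ℝ)
    (m : (Fin d → ℝ) → T → ℝ) : Prop extends IsFamilyC2 μ I m where
  contDiffOn_three : ∀ t, ContDiffOn ℝ 3 (fun x => m x t) (cube d I)
  pd_type_three : ∀ p ∈ cube d I, ∀ i,
    IsLpType μ I 3 (fun x t => pd i (fun y => m y t) x) p
  pd_pd_type_three_halves : ∀ p ∈ cube d I, ∀ i j,
    IsLpType μ I (3 / 2) (fun x t => pd i (pd j (fun y => m y t)) x) p
  pd_pd_pd_type_one : ∀ p ∈ cube d I, ∀ i j l,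
    IsLpType μ I 1 (fun x t => pd i (pd j (pd l (fun y => m y t))) x) p

/-- The centred partial derivative `∂_i^* m (x, t) = ∂_i m (x, t) - ∫ ∂_i m (x, s) dμ(s)`. -/
noncomputable def pdStar {d : ℕ} {T : Type*} [MeasurableSpace T] (μ : Measure T)
    (m : (Fin d → ℝ) → T → ℝ) (i : Fin d) (x : Fin d → ℝ) (t : T) : ℝ :=
  pd i (fun y => m y t) x - ∫ s, pd i (fun y => m y s) x ∂μ

/-! ### Generalized Bajraktarević and Gini means -/

/-- The generalized Bajraktarević mean `M_{f,g,m;μ}` on `J ^ d`: its value at `x ∈ J ^ d` is the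
element `y ∈ J` with `∫ D_{f,g}(m(x,t), y) dμ(t) = 0`. This `y` exists and is unique whenever
`(f, g)` is a Chebyshev system on the open interval `J`, `m` is a measurable family of means on
`J` and `μ` is a probability measure. -/
noncomputable def bajMean {d : ℕ} {T : Type*} [MeasurableSpace T] (J : Set ℝ) (f g : ℝ → ℝ)
    (m : (Fin d → ℝ) → T → ℝ) (μ : Measure T) (x : Fin d → ℝ) : ℝ :=
  Classical.epsilon fun y => y ∈ J ∧ ∫ t, chebDet f g (m x t) y ∂μ = 0

open Classical in
/-- First generating function of the Gini mean with parameters `p, q`, which are either both real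
or non-real conjugates. -/
noncomputable def giniF (p q : ℂ) (x : ℝ) : ℝ :=
  if p.im = 0 then
    if p = q then x ^ p.re * Real.log x else x ^ p.re
  else x ^ p.re * Real.sin (p.im * Real.log x)

open Classical in
/-- Second generating function of the Gini mean with parameters `p, q`. -/
noncomputable def giniG (p q : ℂ) (x : ℝ) : ℝ :=
  if p.im = 0 then x ^ q.re else x ^ p.re * Real.cos (p.im * Real.log x)

/-- The generalized Gini mean `G_{p,q,m;μ}` on `I ^ d`; it is defined if `(giniF p q, giniG p q)`
is a Chebyshev system on `I`. -/
noncomputable def giniMean {d : ℕ} {T : Type*} [MeasurableSpace T] (I : Set ℝ) (p q : ℂ)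
    (m : (Fin d → ℝ) → T → ℝ) (μ : Measure T) (x : Fin d → ℝ) : ℝ :=
  bajMean I (giniF p q) (giniG p q) m μ x

/-- `y` solves `y'' = (α / x) y' + (β / x ^ 2) y` on `I`. -/
def SolvesCauchyEuler (I : Set ℝ) (α β : ℝ) (y : ℝ → ℝ) : Prop :=
  ∀ x ∈ I, deriv (deriv y) x = α / x * deriv y x + β / x ^ 2 * y x

end GenMeans

/-!
The analytic core is `PhiFun_PsiFun_eq_of_bajMean_eq`: if the pairs `(f, g)` and `(h, k)` generate
the same mean, then they have the same invariants `Φ` and `Ψ`. Normalize the determinant as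
`U(z, y) = D_{f,g}(z, y) / W_{f,g}(y)`. With `r = z - y`, it has the locally uniform expansion
`U = r + Φ(y) r² / 2 + K(y) r³ / 6 + o(r³)`, where `K = Φ' + Φ² + Ψ`
(`IsPairC.normKernel_expansion`, `IsPairC.hasDerivAt_PhiFun`). Restrict everything to a segment
`x^{(d)} + s v` with `s → 0+`. As every `m(·, t)` is a mean, `|m(x^{(d)} + s v, t) - x| ≤ s ‖v‖`
uniformly in `t`, so dominated convergence applies with constant bounds and no derivative of `m`
beyond the first is needed. The first order term of the equation `∫ U = 0` shows that the common
mean has slope `∫ ∂_v m` (`tendsto_mean_slope`). The difference of the two normalized determinants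
has integral zero along the mean, and its leading term gives
`(Φ_{h,k} - Φ_{f,g})(x) ∫ (∂_v^* m)² = 0` for all `v`. Once the `Φ`s agree on the interval, so do
their derivatives, and the leading term becomes `(Ψ_{h,k} - Ψ_{f,g})(x) ∫ (∂_v^* m)³ = 0`. The
second moments do not all vanish, and by polarization neither do the third ones. Homogeneity of `m`
carries these two conditions from `x₀` to the whole diagonal (`pdStar_diag_eq_of_homogeneous`).

The remaining implications are of an algebraic nature. Homogeneity of the mean is its equality with
the mean of the rescaled pair (`bajMean_smul`). The invariants of `(f_λ, g_λ)` at `x` are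
`λ Φ(λ x)` and `λ² Ψ(λ x)`, so their equality with `Φ(x)` and `Ψ(x)` says that `x Φ(x)` and
`x² Ψ(x)` are constant, that is, that `f` and `g` solve a Cauchy–Euler equation. Two fundamental
systems of one second order linear equation are equivalent, since quotients of Wronskians are
constant (`pairsEquivalent_of_isLinearSolution`), and equivalent pairs generate the same mean. This
applies to `(f, g)` and its rescalings, and to `(f, g)` and the Gini pair whose exponents are the
roots of the indicial equation. Conversely, a Gini pair solves a Cauchy–Euler equation, so its mean
is homogeneous.
-/

namespace GenMeans

open Filter Topology Asymptotics Set

/-! ### Existence and uniqueness of the generalized Bajraktarević mean -/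

section BajraktarevicMean

variable {T : Type*} [MeasurableSpace T] {μ : Measure T} [IsProbabilityMeasure μ]

lemma chebDet_swap (f g : ℝ → ℝ) (x y : ℝ) : chebDet f g y x = -chebDet f g x y := by
  unfold chebDet; ring

lemma chebDet_self (f g : ℝ → ℝ) (x : ℝ) : chebDet f g x x = 0 := by
  unfold chebDet; ring

lemma integrable_comp_of_continuousOn {φ : ℝ → ℝ} {a b : ℝ} (hφ : ContinuousOn φ (Icc a b))
    {X : T → ℝ} (hX : Measurable X) (hXab : ∀ t, X t ∈ Icc a b) :
    Integrable (fun t => φ (X t)) μ := by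
  obtain ⟨t₀⟩ := nonempty_of_isProbabilityMeasure μ
  have hab : a ≤ b := (hXab t₀).1.trans (hXab t₀).2
  have hext : (fun t => φ (X t)) = fun t => IccExtend hab ((Icc a b).domRestrict φ) (X t) := by
    funext t
    exact (IccExtend_of_mem hab ((Icc a b).domRestrict φ) (hXab t)).symm
  obtain ⟨C, hC⟩ := isCompact_Icc.exists_bound_of_continuousOn hφ
  refine Integrable.of_bound (C := C) ?_ (ae_of_all _ fun t => hC _ (hXab t))
  rw [hext]
  exact ((hφ.domRestrict.Icc_extend').measurable.comp hX).aestronglyMeasurable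

lemma exists_eq_zero_of_integral_comp_eq_zero {φ : ℝ → ℝ} {a b : ℝ}
    (hφ : ContinuousOn φ (Icc a b)) {X : T → ℝ} (hX : Measurable X)
    (hXab : ∀ t, X t ∈ Icc a b) (h0 : ∫ t, φ (X t) ∂μ = 0) : ∃ z ∈ Icc a b, φ z = 0 := by
  have hint := integrable_comp_of_continuousOn (μ := μ) hφ hX hXab
  obtain ⟨t₁, ht₁⟩ := exists_le_integral hint
  obtain ⟨t₂, ht₂⟩ := exists_integral_le hint
  rw [h0] at ht₁ ht₂
  exact isPreconnected_Icc.intermediate_value (hXab t₁) (hXab t₂) hφ ⟨ht₁, ht₂⟩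

variable {J : Set ℝ} {f g : ℝ → ℝ}

lemma IsChebyshev.swap (h : IsChebyshev J f g) : IsChebyshev J g f where
  continuousOn_left := h.continuousOn_right
  continuousOn_right := h.continuousOn_left
  det_ne_zero x hx y hy hxy := by
    have := h.det_ne_zero x hx y hy hxy
    unfold chebDet at *
    contrapose! this
    linarith

lemma IsChebyshev.mono {K : Set ℝ} (h : IsChebyshev J f g) (hK : K ⊆ J) : IsChebyshev K f g where
  continuousOn_left := h.continuousOn_left.mono hK
  continuousOn_right := h.continuousOn_right.mono hK
  det_ne_zero x hx y hy hxy := h.det_ne_zero x (hK hx) y (hK hy) hxy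

lemma IsChebyshev.continuousOn_chebDet (h : IsChebyshev J f g) (y : ℝ) :
    ContinuousOn (fun z => chebDet f g z y) J := by
  unfold chebDet
  exact (h.continuousOn_left.mul continuousOn_const).sub
    (continuousOn_const.mul h.continuousOn_right)

/-- `D(·, a)` does not vanish on `(a, b]` and `D(·, b)` does not vanish on `[a, b)`, so each keeps
the sign that `D(b, a)` gives it. -/
lemma IsChebyshev.chebDet_nonneg {a b : ℝ} (h : IsChebyshev (Icc a b) f g)
    (hpos : 0 < chebDet f g b a) {z : ℝ} (hz : z ∈ Icc a b) :
    0 ≤ chebDet f g z a ∧ chebDet f g z b ≤ 0 := by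
  have hab : a ≤ b := hz.1.trans hz.2
  constructor
  · rcases hz.1.eq_or_lt with rfl | haz
    · rw [chebDet_self]
    · by_contra! hneg
      obtain ⟨w, hw, hw0⟩ := isPreconnected_Ioc.intermediate_value (s := Ioc a b) ⟨haz, hz.2⟩
        ⟨haz.trans_le hz.2, le_rfl⟩
        ((h.continuousOn_chebDet a).mono Ioc_subset_Icc_self) ⟨hneg.le, hpos.le⟩
      exact h.det_ne_zero w ⟨hw.1.le, hw.2⟩ a ⟨le_rfl, hab⟩ hw.1.ne' hw0
  · rcases hz.2.eq_or_lt with rfl | hzb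
    · rw [chebDet_self]
    · by_contra! hneg
      rw [chebDet_swap, Left.neg_pos_iff] at hpos
      obtain ⟨w, hw, hw0⟩ := isPreconnected_Ico.intermediate_value (s := Ico a b)
        ⟨le_rfl, hz.1.trans_lt hzb⟩ ⟨hz.1, hzb⟩
        ((h.continuousOn_chebDet b).mono Ico_subset_Icc_self) ⟨hpos.le, hneg.le⟩
      exact h.det_ne_zero w ⟨hw.1, hw.2.le⟩ b ⟨hab, le_rfl⟩ hw.2.ne hw0

variable {X : T → ℝ} {a b : ℝ}

lemma IsChebyshev.integrable_chebDet (h : IsChebyshev (Icc a b) f g) (hX : Measurable X)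
    (hXab : ∀ t, X t ∈ Icc a b) (y : ℝ) : Integrable (fun t => chebDet f g (X t) y) μ :=
  integrable_comp_of_continuousOn (h.continuousOn_chebDet y) hX hXab

lemma IsChebyshev.integral_chebDet (h : IsChebyshev (Icc a b) f g) (hX : Measurable X)
    (hXab : ∀ t, X t ∈ Icc a b) (y : ℝ) :
    ∫ t, chebDet f g (X t) y ∂μ = (∫ t, f (X t) ∂μ) * g y - f y * ∫ t, g (X t) ∂μ := by
  have hf := integrable_comp_of_continuousOn (μ := μ) h.continuousOn_left hX hXab
  have hg := integrable_comp_of_continuousOn (μ := μ) h.continuousOn_right hX hXab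
  unfold chebDet
  rw [integral_sub (hf.mul_const _) (hg.const_mul _), integral_mul_const, integral_const_mul]

/-- The integral of `D(X, y)` has opposite signs at `y = a` and `y = b`. -/
lemma IsChebyshev.exists_integral_chebDet_eq_zero (h : IsChebyshev (Icc a b) f g)
    (hX : Measurable X) (hXab : ∀ t, X t ∈ Icc a b) :
    ∃ y ∈ Icc a b, ∫ t, chebDet f g (X t) y ∂μ = 0 := by
  obtain ⟨t₀⟩ := nonempty_of_isProbabilityMeasure μ
  have hab : a ≤ b := (hXab t₀).1.trans (hXab t₀).2
  rcases hab.eq_or_lt with rfl | hlt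
  · refine ⟨a, ⟨le_rfl, le_rfl⟩, ?_⟩
    have : ∀ t, X t = a := fun t => le_antisymm (hXab t).2 (hXab t).1
    simp [this, chebDet_self]
  -- interchanging `f` and `g`, the determinant at `(b, a)` may be assumed positive
  wlog hpos : 0 < chebDet f g b a generalizing f g
  · have hne := h.det_ne_zero b ⟨hab, le_rfl⟩ a ⟨le_rfl, hab⟩ hlt.ne'
    have hflip : ∀ x y, chebDet g f x y = -chebDet f g x y := fun x y => by
      unfold chebDet; ring
    obtain ⟨y, hy, hy0⟩ := this h.swap (by
      rw [hflip]; exact neg_pos.2 (lt_of_le_of_ne (not_lt.1 hpos) hne))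
    refine ⟨y, hy, ?_⟩
    simpa only [hflip, integral_neg, neg_eq_zero] using hy0
  have hcont : ContinuousOn (fun y => ∫ t, chebDet f g (X t) y ∂μ) (Icc a b) := by
    simp only [h.integral_chebDet hX hXab]
    exact (continuousOn_const.mul h.continuousOn_right).sub
      (h.continuousOn_left.mul continuousOn_const)
  obtain ⟨y, hy, hy0⟩ := isPreconnected_Icc.intermediate_value (s := Icc a b)
    ⟨hab, le_rfl⟩ ⟨le_rfl, hab⟩ hcont
    ⟨integral_nonpos fun t => (h.chebDet_nonneg hpos (hXab t)).2,
      integral_nonneg fun t => (h.chebDet_nonneg hpos (hXab t)).1⟩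
  exact ⟨y, hy, hy0⟩

/-- Two different zeros would force both `∫ f ∘ X` and `∫ g ∘ X` to vanish; then the determinant
against a point `y₀` of `J` to the left of the range of `X` would have integral zero, although it
vanishes nowhere on that range. -/
lemma IsChebyshev.eq_of_integral_chebDet_eq_zero (h : IsChebyshev J f g) (hJ : IsOpen J)
    (hX : Measurable X) (hXab : ∀ t, X t ∈ Icc a b) (habJ : Icc a b ⊆ J) {y z : ℝ}
    (hy : y ∈ J) (hz : z ∈ J) (hy0 : ∫ t, chebDet f g (X t) y ∂μ = 0)
    (hz0 : ∫ t, chebDet f g (X t) z ∂μ = 0) : y = z := by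
  obtain ⟨t₀⟩ := nonempty_of_isProbabilityMeasure μ
  have hab : a ≤ b := (hXab t₀).1.trans (hXab t₀).2
  by_contra hne
  have hdet := h.det_ne_zero y hy z hz hne
  have hI := (h.mono habJ).integral_chebDet (μ := μ) hX hXab
  rw [hI] at hy0 hz0
  set F := ∫ t, f (X t) ∂μ
  set G := ∫ t, g (X t) ∂μ
  have hF : F = 0 := by
    refine (mul_eq_zero.1 (?_ : F * chebDet f g y z = 0)).resolve_right hdet
    unfold chebDet; linear_combination f y * hz0 - f z * hy0
  have hG : G = 0 := by
    refine (mul_eq_zero.1 (?_ : G * chebDet f g y z = 0)).resolve_right hdet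
    unfold chebDet; linear_combination g y * hz0 - g z * hy0
  obtain ⟨y₀, hy₀a, hy₀⟩ : ∃ y₀ < a, y₀ ∈ J := by
    obtain ⟨l, hl, hlJ⟩ := exists_Ioc_subset_of_mem_nhds
      (hJ.mem_nhds (habJ ⟨le_rfl, hab⟩)) ⟨a - 1, by linarith⟩
    obtain ⟨y₀, hly, hya⟩ := exists_between hl
    exact ⟨y₀, hya, hlJ ⟨hly, hya.le⟩⟩
  obtain ⟨w, hw, hw0⟩ := exists_eq_zero_of_integral_comp_eq_zero (μ := μ)
    (((h.mono habJ).continuousOn_chebDet y₀)) hX hXab (by rw [hI, hF, hG]; ring)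
  exact h.det_ne_zero w (habJ hw) y₀ hy₀ (hy₀a.trans_le hw.1).ne' hw0

variable {d : ℕ} [NeZero d] {I : Set ℝ} {m : (Fin d → ℝ) → T → ℝ}

lemma Icc_iInf_iSup_subset (hJ : J.OrdConnected) {x : Fin d → ℝ} (hx : x ∈ cube d J) :
    Icc (⨅ i, x i) (⨆ i, x i) ⊆ J := by
  obtain ⟨i, hi⟩ := exists_eq_ciInf_of_finite (f := x)
  obtain ⟨j, hj⟩ := exists_eq_ciSup_of_finite (f := x)
  rw [← hi, ← hj]
  exact hJ.out (hx i) (hx j)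

lemma bajMean_spec (hJo : IsOpen J) (hJ : J.OrdConnected) (hJI : J ⊆ I) (h : IsChebyshev J f g)
    (hm : IsMeasurableFamily I m) {x : Fin d → ℝ} (hx : x ∈ cube d J) :
    bajMean J f g m μ x ∈ Icc (⨅ i, x i) (⨆ i, x i) ∧
      ∫ t, chebDet f g (m x t) (bajMean J f g m μ x) ∂μ = 0 := by
  have hxI : x ∈ cube d I := fun i => hJI (hx i)
  have hsub := Icc_iInf_iSup_subset hJ hx
  have hX := hm.measurable x hxI
  have hXab : ∀ t, m x t ∈ Icc (⨅ i, x i) (⨆ i, x i) := fun t => (hm.isMean t x hxI).2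
  obtain ⟨y, hy, hy0⟩ := (h.mono hsub).exists_integral_chebDet_eq_zero (μ := μ) hX hXab
  have hspec : bajMean J f g m μ x ∈ J ∧
      ∫ t, chebDet f g (m x t) (bajMean J f g m μ x) ∂μ = 0 :=
    Classical.epsilon_spec (p := fun y => y ∈ J ∧ ∫ t, chebDet f g (m x t) y ∂μ = 0)
      ⟨y, hsub hy, hy0⟩
  have heq := h.eq_of_integral_chebDet_eq_zero hJo hX hXab hsub hspec.1 (hsub hy) hspec.2 hy0
  exact ⟨heq ▸ hy, hspec.2⟩

lemma bajMean_mem (hJo : IsOpen J) (hJ : J.OrdConnected) (hJI : J ⊆ I) (h : IsChebyshev J f g)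
    (hm : IsMeasurableFamily I m) {x : Fin d → ℝ} (hx : x ∈ cube d J) :
    bajMean J f g m μ x ∈ J :=
  Icc_iInf_iSup_subset hJ hx (bajMean_spec hJo hJ hJI h hm hx).1

lemma bajMean_eq (hJo : IsOpen J) (hJ : J.OrdConnected) (hJI : J ⊆ I) (h : IsChebyshev J f g)
    (hm : IsMeasurableFamily I m) {x : Fin d → ℝ} (hx : x ∈ cube d J) {y : ℝ} (hy : y ∈ J)
    (hy0 : ∫ t, chebDet f g (m x t) y ∂μ = 0) : bajMean J f g m μ x = y := by
  have hxI : x ∈ cube d I := fun i => hJI (hx i)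
  exact h.eq_of_integral_chebDet_eq_zero hJo (hm.measurable x hxI)
    (fun t => (hm.isMean t x hxI).2) (Icc_iInf_iSup_subset hJ hx)
    (bajMean_mem hJo hJ hJI h hm hx) hy (bajMean_spec hJo hJ hJI h hm hx).2 hy0

end BajraktarevicMean

/-! ### A locally uniform Taylor expansion -/

section Taylor

/-- A remainder `G (y, z)` vanishing at `z = y` gains one order when its `z`-derivative is
`o((z - y) ^ n)`, uniformly as `y` and `z` tend to `x`. -/
lemma isLittleO_of_hasDerivAt {G H : ℝ → ℝ → ℝ} {x : ℝ} {J : Set ℝ} (hJ : IsOpen J) (hx : x ∈ J)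
    {n : ℕ} (hG : ∀ y ∈ J, ∀ z ∈ J, HasDerivAt (G y) (H y z) z) (hG0 : ∀ y ∈ J, G y y = 0)
    (hH : (fun p : ℝ × ℝ => H p.1 p.2) =o[𝓝 (x, x)] fun p => (p.2 - p.1) ^ n) :
    (fun p : ℝ × ℝ => G p.1 p.2) =o[𝓝 (x, x)] fun p => (p.2 - p.1) ^ (n + 1) := by
  rw [isLittleO_iff] at hH ⊢
  intro ε hε
  obtain ⟨δ, hδ, hball⟩ := Metric.eventually_nhds_iff_ball.1
    ((hH hε).and ((hJ.prod hJ).mem_nhds (⟨hx, hx⟩ : (x, x) ∈ J ×ˢ J)))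
  filter_upwards [Metric.ball_mem_nhds (x, x) hδ] with p hp
  rw [← ball_prod_same] at hball hp
  have hmem : ∀ w ∈ uIcc p.1 p.2, w ∈ Metric.ball x δ := fun w hw =>
    (convex_ball x δ).ordConnected.uIcc_subset hp.1 hp.2 hw
  have hbound : ∀ w ∈ uIcc p.1 p.2, ‖H p.1 w‖ ≤ ε * |p.2 - p.1| ^ n := by
    intro w hw
    have h1 := (hball (p.1, w) ⟨hp.1, hmem w hw⟩).1
    simp only [norm_pow, Real.norm_eq_abs] at h1 ⊢
    have h2 : |w - p.1| ≤ |p.2 - p.1| := abs_sub_left_of_mem_uIcc hw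
    exact h1.trans (by gcongr)
  have := (convex_uIcc p.1 p.2).norm_image_sub_le_of_norm_hasDerivWithin_le
    (f := G p.1) (f' := H p.1)
    (fun w hw => (hG p.1 (hball _ hp).2.1 w
      (hball (p.1, w) ⟨hp.1, hmem w hw⟩).2.2).hasDerivWithinAt) hbound
    left_mem_uIcc right_mem_uIcc
  rw [hG0 _ (hball _ hp).2.1, sub_zero] at this
  refine this.trans_eq ?_
  rw [norm_pow, Real.norm_eq_abs, pow_succ, mul_assoc]

variable {J : Set ℝ} {f g : ℝ → ℝ}

lemma hasDerivAt_of_contDiffOn (hJ : IsOpen J) {n : ℕ} (hn : n ≠ 0) (hf : ContDiffOn ℝ n f J)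
    {x : ℝ} (hx : x ∈ J) : HasDerivAt f (deriv f x) x :=
  ((hf.differentiableOn (by exact_mod_cast hn)).differentiableAt (hJ.mem_nhds hx)).hasDerivAt

lemma contDiffOn_deriv (hJ : IsOpen J) {n : ℕ} (hf : ContDiffOn ℝ (n + 1 : ℕ) f J) :
    ContDiffOn ℝ n (deriv f) J :=
  hf.deriv_of_isOpen hJ (by norm_cast)

/-- Starting from the continuity of `f'''` at `x`, three integrations in `z` give the third order
remainder, with the base point `y` moving together with `z`. -/
lemma taylor_three_isLittleO (hJ : IsOpen J) (hf : ContDiffOn ℝ 3 f J) {x : ℝ} (hx : x ∈ J) :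
    (fun p : ℝ × ℝ => f p.2 - (f p.1 + deriv f p.1 * (p.2 - p.1)
      + deriv (deriv f) p.1 / 2 * (p.2 - p.1) ^ 2
      + deriv (deriv (deriv f)) p.1 / 6 * (p.2 - p.1) ^ 3))
      =o[𝓝 (x, x)] fun p => (p.2 - p.1) ^ 3 := by
  have h0 : ContDiffOn ℝ (3 : ℕ) f J := hf
  have h1 := contDiffOn_deriv hJ h0
  have h2 := contDiffOn_deriv hJ h1
  have h3 := contDiffOn_deriv hJ h2
  have hlin : ∀ y z : ℝ, HasDerivAt (fun z => z - y) 1 z := fun y z =>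
    (hasDerivAt_id z).sub_const y
  have e3 : (fun p : ℝ × ℝ => deriv (deriv (deriv f)) p.2 - deriv (deriv (deriv f)) p.1)
      =o[𝓝 (x, x)] fun p => (p.2 - p.1) ^ 0 := by
    have hc := h3.continuousOn.continuousAt (hJ.mem_nhds hx)
    simp only [pow_zero]
    rw [isLittleO_one_iff]
    have h1 : Tendsto (fun p : ℝ × ℝ => deriv (deriv (deriv f)) p.2) (𝓝 (x, x))
        (𝓝 (deriv (deriv (deriv f)) x)) := hc.tendsto.comp (continuous_snd.tendsto (x, x))
    have h2 : Tendsto (fun p : ℝ × ℝ => deriv (deriv (deriv f)) p.1) (𝓝 (x, x))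
        (𝓝 (deriv (deriv (deriv f)) x)) := hc.tendsto.comp (continuous_fst.tendsto (x, x))
    simpa using h1.sub h2
  have e2 := isLittleO_of_hasDerivAt hJ hx
    (G := fun y z => deriv (deriv f) z - (deriv (deriv f) y + deriv (deriv (deriv f)) y * (z - y)))
    (H := fun y z => deriv (deriv (deriv f)) z - deriv (deriv (deriv f)) y)
    (fun y hy z hz => by
      refine ((hasDerivAt_of_contDiffOn hJ one_ne_zero h2 hz).sub
        (((hlin y z).const_mul _).const_add _)).congr_deriv ?_
      ring) (fun y _ => by ring) e3
  have e1 := isLittleO_of_hasDerivAt hJ hx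
    (G := fun y z => deriv f z - (deriv f y + deriv (deriv f) y * (z - y)
      + deriv (deriv (deriv f)) y / 2 * (z - y) ^ 2))
    (H := fun y z => deriv (deriv f) z
      - (deriv (deriv f) y + deriv (deriv (deriv f)) y * (z - y)))
    (fun y hy z hz => by
      refine ((hasDerivAt_of_contDiffOn hJ two_ne_zero h1 hz).sub
        ((((hlin y z).const_mul _).const_add _).add
          (((hlin y z).pow 2).const_mul _))).congr_deriv ?_
      push_cast
      ring) (fun y _ => by ring) e2
  exact isLittleO_of_hasDerivAt hJ hx
    (G := fun y z => f z - (f y + deriv f y * (z - y)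
      + deriv (deriv f) y / 2 * (z - y) ^ 2 + deriv (deriv (deriv f)) y / 6 * (z - y) ^ 3))
    (H := fun y z => deriv f z - (deriv f y + deriv (deriv f) y * (z - y)
      + deriv (deriv (deriv f)) y / 2 * (z - y) ^ 2))
    (fun y hy z hz => by
      refine ((hasDerivAt_of_contDiffOn hJ three_ne_zero h0 hz).sub
        (((((hlin y z).const_mul _).const_add _).add
          (((hlin y z).pow 2).const_mul _)).add (((hlin y z).pow 3).const_mul _))).congr_deriv ?_
      push_cast
      ring) (fun y _ => by ring) e1

end Taylor

/-! ### Expansion of the normalized determinant -/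

section Kernel

variable {J : Set ℝ} {f g h k : ℝ → ℝ}

/-- The determinant `D_{f,g}(z, y)`, normalized so that its `z`-derivative at `z = y` is `1`.
The argument is the pair `p = (y, z)`: the base point comes first. -/
noncomputable def normKernel (f g : ℝ → ℝ) (p : ℝ × ℝ) : ℝ :=
  chebDet f g p.2 p.1 / wronski f g p.1

/-- The third derivative at `z = y` of the normalized determinant. -/
noncomputable def thirdCoeff (f g : ℝ → ℝ) (y : ℝ) : ℝ :=
  (deriv (deriv (deriv f)) y * g y - f y * deriv (deriv (deriv g)) y) / wronski f g y

lemma isBigO_one_of_continuousAt {a : ℝ → ℝ} {x : ℝ} (ha : ContinuousAt a x) :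
    (fun p : ℝ × ℝ => a p.1) =O[𝓝 (x, x)] fun _ => (1 : ℝ) :=
  (ha.tendsto.comp (continuous_fst.tendsto (x, x))).isBigO_one ℝ

lemma tendsto_sub_nhds_prod (x : ℝ) :
    Tendsto (fun p : ℝ × ℝ => p.2 - p.1) (𝓝 (x, x)) (𝓝 0) := by
  have : Continuous fun p : ℝ × ℝ => p.2 - p.1 := continuous_snd.sub continuous_fst
  simpa using this.tendsto (x, x)

lemma isLittleO_coeff_mul_pow_succ {a : ℝ → ℝ} {x : ℝ} (ha : ContinuousAt a x) {n m : ℕ}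
    (hnm : n < m) :
    (fun p : ℝ × ℝ => a p.1 * (p.2 - p.1) ^ m) =o[𝓝 (x, x)] fun p => (p.2 - p.1) ^ n := by
  simpa using (isBigO_one_of_continuousAt ha).mul_isLittleO
    ((isLittleO_pow_pow hnm).comp_tendsto (tendsto_sub_nhds_prod x))

lemma isLittleO_coeff_sub_mul_pow {a : ℝ → ℝ} {x : ℝ} (ha : ContinuousAt a x) (n : ℕ) :
    (fun p : ℝ × ℝ => (a p.1 - a x) * (p.2 - p.1) ^ n) =o[𝓝 (x, x)]
      fun p => (p.2 - p.1) ^ n := by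
  have h0 : (fun p : ℝ × ℝ => a p.1 - a x) =o[𝓝 (x, x)] fun _ => (1 : ℝ) := by
    rw [isLittleO_one_iff]
    simpa using (ha.tendsto.comp (continuous_fst.tendsto (x, x))).sub_const (a x)
  simpa using h0.mul_isBigO (isBigO_refl (fun p : ℝ × ℝ => (p.2 - p.1) ^ n) _)

section Regularity

variable (hJ : IsOpen J) (hp : IsPairC 3 J f g) {x : ℝ} (hx : x ∈ J)
include hJ hp hx

lemma IsPairC.hasDerivAts : (HasDerivAt f (deriv f x) x ∧ HasDerivAt g (deriv g x) x) ∧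
    (HasDerivAt (deriv f) (deriv (deriv f) x) x ∧ HasDerivAt (deriv g) (deriv (deriv g) x) x) ∧
    (HasDerivAt (deriv (deriv f)) (deriv (deriv (deriv f)) x) x ∧
      HasDerivAt (deriv (deriv g)) (deriv (deriv (deriv g)) x) x) ∧
    ContinuousAt (deriv (deriv (deriv f))) x ∧ ContinuousAt (deriv (deriv (deriv g))) x := by
  have f1 := contDiffOn_deriv hJ (hp.contDiffOn_left : ContDiffOn ℝ (3 : ℕ) f J)
  have f2 := contDiffOn_deriv hJ f1
  have f3 := contDiffOn_deriv hJ f2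
  have g1 := contDiffOn_deriv hJ (hp.contDiffOn_right : ContDiffOn ℝ (3 : ℕ) g J)
  have g2 := contDiffOn_deriv hJ g1
  have g3 := contDiffOn_deriv hJ g2
  exact ⟨⟨hasDerivAt_of_contDiffOn hJ three_ne_zero hp.contDiffOn_left hx,
      hasDerivAt_of_contDiffOn hJ three_ne_zero hp.contDiffOn_right hx⟩,
    ⟨hasDerivAt_of_contDiffOn hJ two_ne_zero f1 hx,
      hasDerivAt_of_contDiffOn hJ two_ne_zero g1 hx⟩,
    ⟨hasDerivAt_of_contDiffOn hJ one_ne_zero f2 hx,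
      hasDerivAt_of_contDiffOn hJ one_ne_zero g2 hx⟩,
    f3.continuousOn.continuousAt (hJ.mem_nhds hx), g3.continuousOn.continuousAt (hJ.mem_nhds hx)⟩

lemma IsPairC.hasDerivAt_wronski : HasDerivAt (wronski f g)
    (deriv (deriv f) x * g x - f x * deriv (deriv g) x) x := by
  obtain ⟨⟨f1, g1⟩, ⟨f2, g2⟩, -⟩ := hp.hasDerivAts hJ hx
  refine ((f2.mul g1).sub (f1.mul g2)).congr_deriv ?_
  ring

/-- `Φ' = K - Φ ^ 2 - Ψ`, where `K` is the third derivative of the normalized determinant. -/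
lemma IsPairC.hasDerivAt_PhiFun : HasDerivAt (PhiFun f g)
    (thirdCoeff f g x - PhiFun f g x ^ 2 - PsiFun f g x) x := by
  obtain ⟨⟨f1, g1⟩, ⟨f2, g2⟩, ⟨f3, g3⟩, -⟩ := hp.hasDerivAts hJ hx
  have hW := hp.wronski_ne_zero x hx
  refine (((f3.mul g1).sub (f1.mul g3)).div (hp.hasDerivAt_wronski hJ hx) hW).congr_deriv ?_
  simp only [thirdCoeff, PhiFun, PsiFun, Pi.sub_apply, Pi.mul_apply]
  field_simp
  ring

lemma IsPairC.continuousAt_thirdCoeff : ContinuousAt (thirdCoeff f g) x := by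
  obtain ⟨⟨f1, g1⟩, -, -, f3, g3⟩ := hp.hasDerivAts hJ hx
  exact ((f3.mul g1.continuousAt).sub (f1.continuousAt.mul g3)).div
    (hp.hasDerivAt_wronski hJ hx).continuousAt (hp.wronski_ne_zero x hx)

lemma IsPairC.normKernel_expansion :
    (fun p : ℝ × ℝ => normKernel f g p - ((p.2 - p.1) + PhiFun f g p.1 / 2 * (p.2 - p.1) ^ 2
      + thirdCoeff f g p.1 / 6 * (p.2 - p.1) ^ 3)) =o[𝓝 (x, x)] fun p => (p.2 - p.1) ^ 3 := by
  obtain ⟨⟨f1, g1⟩, -⟩ := hp.hasDerivAts hJ hx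
  have hW := (hp.hasDerivAt_wronski hJ hx).continuousAt
  have hW0 := hp.wronski_ne_zero x hx
  have hf := (isBigO_one_of_continuousAt (g1.continuousAt.div hW hW0)).mul_isLittleO
    (taylor_three_isLittleO hJ hp.contDiffOn_left hx)
  have hg := (isBigO_one_of_continuousAt (f1.continuousAt.div hW hW0)).mul_isLittleO
    (taylor_three_isLittleO hJ hp.contDiffOn_right hx)
  refine (hf.sub hg).congr' ?_ (Eventually.of_forall fun p => one_mul _)
  filter_upwards [(hJ.prod hJ).mem_nhds (⟨hx, hx⟩ : (x, x) ∈ J ×ˢ J)] with p hpJ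
  have hWp := hp.wronski_ne_zero p.1 hpJ.1
  simp only [normKernel, thirdCoeff, PhiFun, chebDet, Pi.div_apply]
  field_simp
  unfold wronski
  ring

lemma IsPairC.normKernel_sub_isLittleO :
    (fun p : ℝ × ℝ => normKernel f g p - (p.2 - p.1)) =o[𝓝 (x, x)] fun p => p.2 - p.1 := by
  have h1 := isLittleO_coeff_mul_pow_succ ((hp.hasDerivAt_PhiFun hJ hx).continuousAt.div_const 2)
    (show 1 < 2 by norm_num)
  have h2 := isLittleO_coeff_mul_pow_succ ((hp.continuousAt_thirdCoeff hJ hx).div_const 6)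
    (show 1 < 3 by norm_num)
  have h3 := (hp.normKernel_expansion hJ hx).trans
    ((isLittleO_pow_pow (show 1 < 3 by norm_num)).comp_tendsto (tendsto_sub_nhds_prod x))
  refine ((h1.add h2).add h3).congr (fun p => ?_) fun p => pow_one _
  ring

variable (hq : IsPairC 3 J h k)
include hq

lemma normKernel_sub_normKernel_two :
    (fun p : ℝ × ℝ => normKernel h k p - normKernel f g p
      - (PhiFun h k x - PhiFun f g x) / 2 * (p.2 - p.1) ^ 2) =o[𝓝 (x, x)]
        fun p => (p.2 - p.1) ^ 2 := by
  have hΦ := ((hq.hasDerivAt_PhiFun hJ hx).continuousAt.sub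
    (hp.hasDerivAt_PhiFun hJ hx).continuousAt).div_const 2
  have h1 := isLittleO_coeff_sub_mul_pow hΦ 2
  have h2 := isLittleO_coeff_mul_pow_succ (((hq.continuousAt_thirdCoeff hJ hx).sub
    (hp.continuousAt_thirdCoeff hJ hx)).div_const 6) (show 2 < 3 by norm_num)
  have h3 := ((hq.normKernel_expansion hJ hx).sub (hp.normKernel_expansion hJ hx)).trans
    ((isLittleO_pow_pow (show 2 < 3 by norm_num)).comp_tendsto (tendsto_sub_nhds_prod x))
  refine ((h1.add h2).add h3).congr_left fun p => ?_
  simp only [Pi.sub_apply]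
  ring

lemma normKernel_sub_normKernel_three (hΦ : ∀ y ∈ J, PhiFun f g y = PhiFun h k y) :
    (fun p : ℝ × ℝ => normKernel h k p - normKernel f g p
      - (PsiFun h k x - PsiFun f g x) / 6 * (p.2 - p.1) ^ 3) =o[𝓝 (x, x)]
        fun p => (p.2 - p.1) ^ 3 := by
  -- differentiating the identity of the `Φ`s turns the third coefficient into `Ψ`
  have hK : thirdCoeff h k x - thirdCoeff f g x = PsiFun h k x - PsiFun f g x := by
    have heq : PhiFun f g =ᶠ[𝓝 x] PhiFun h k := by
      filter_upwards [hJ.mem_nhds hx] with y hy using hΦ y hy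
    have := ((hp.hasDerivAt_PhiFun hJ hx).congr_of_eventuallyEq heq.symm).unique
      (hq.hasDerivAt_PhiFun hJ hx)
    rw [hΦ x hx] at this
    linarith
  have h1 := isLittleO_coeff_sub_mul_pow (((hq.continuousAt_thirdCoeff hJ hx).sub
    (hp.continuousAt_thirdCoeff hJ hx)).div_const 6) 3
  have h3 := (hq.normKernel_expansion hJ hx).sub (hp.normKernel_expansion hJ hx)
  refine (h1.add h3).congr' ?_ EventuallyEq.rfl
  filter_upwards [(hJ.prod hJ).mem_nhds (⟨hx, hx⟩ : (x, x) ∈ J ×ˢ J)] with p hpJ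
  rw [hΦ p.1 hpJ.1, ← hK]
  simp only [Pi.sub_apply]
  ring

end Regularity

end Kernel

/-! ### Moments of a family of curves along a common mean -/

section Moments

variable {T : Type*} [MeasurableSpace T] {μ : Measure T} [IsProbabilityMeasure μ]
  {X : ℝ → T → ℝ} {Y : ℝ → ℝ} {Z : T → ℝ} {x C : ℝ}

/-- Since `X s` and `Y s` are within `C s` of `x`, the little-o bound is uniform in `t` and can be
integrated without any measurability of `R`. -/
lemma tendsto_integral_div_pow_of_isLittleO {R : ℝ × ℝ → ℝ} {n : ℕ}
    (hR : R =o[𝓝 (x, x)] fun p => (p.2 - p.1) ^ n)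
    (hX : ∀ᶠ s in 𝓝[>] 0, ∀ t, |X s t - x| ≤ C * s)
    (hY : ∀ᶠ s in 𝓝[>] 0, |Y s - x| ≤ C * s) :
    Tendsto (fun s => (∫ t, R (Y s, X s t) ∂μ) / s ^ n) (𝓝[>] 0) (𝓝 0) := by
  obtain ⟨t₀⟩ := nonempty_of_isProbabilityMeasure μ
  have hC : 0 ≤ C := by
    obtain ⟨s, hs, hs0⟩ := (hX.and self_mem_nhdsWithin).exists
    exact nonneg_of_mul_nonneg_left ((abs_nonneg _).trans (hs t₀)) hs0
  rw [← isLittleO_one_iff ℝ, isLittleO_iff]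
  intro ε hε
  -- `|X s t - Y s| ≤ 2 C s` will cost the factor `(2 C) ^ n`; adding `1` keeps `η` positive
  set η := ε / ((2 * C) ^ n + 1)
  have hη : 0 < η := by positivity
  obtain ⟨δ, hδ, hball⟩ := Metric.eventually_nhds_iff_ball.1 (isLittleO_iff.1 hR hη)
  have hsmall : ∀ᶠ s in 𝓝[>] (0 : ℝ), C * s < δ := by
    have : Tendsto (fun s : ℝ => C * s) (𝓝[>] 0) (𝓝 0) := by
      have h := ((continuous_const_mul C).tendsto (0 : ℝ)).mono_left
        (nhdsWithin_le_nhds (s := Ioi 0))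
      simpa using h
    exact this.eventually_lt_const hδ
  filter_upwards [hX, hY, hsmall, self_mem_nhdsWithin] with s hXs hYs hs hs0
  have hs0 : 0 < s := hs0
  have hb : ∀ t, ‖R (Y s, X s t)‖ ≤ η * (2 * C * s) ^ n := by
    intro t
    refine (hball (Y s, X s t) ?_).trans ?_
    · rw [← ball_prod_same]
      exact ⟨(hYs.trans_lt hs), ((hXs t).trans_lt hs)⟩
    · rw [norm_pow, Real.norm_eq_abs]
      gcongr
      calc |X s t - Y s| = |(X s t - x) - (Y s - x)| := by ring_nf
        _ ≤ |X s t - x| + |Y s - x| := abs_sub _ _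
        _ ≤ 2 * C * s := by linarith [hXs t]
  have hint : ‖∫ t, R (Y s, X s t) ∂μ‖ ≤ η * (2 * C * s) ^ n := by
    simpa using norm_integral_le_of_norm_le_const (μ := μ) (ae_of_all _ hb)
  rw [norm_div, norm_pow, Real.norm_of_nonneg hs0.le, norm_one, mul_one,
    div_le_iff₀ (by positivity)]
  refine hint.trans ?_
  rw [mul_pow, ← mul_assoc]
  gcongr
  rw [div_mul_eq_mul_div, div_le_iff₀ (by positivity)]
  nlinarith

/-- The mean `Y s` of the family `X s` has the average of the derivatives of `X` as its
derivative. -/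
lemma tendsto_mean_slope {U : ℝ × ℝ → ℝ}
    (hU : (fun p => U p - (p.2 - p.1)) =o[𝓝 (x, x)] fun p => p.2 - p.1)
    (hX : ∀ᶠ s in 𝓝[>] 0, ∀ t, |X s t - x| ≤ C * s)
    (hY : ∀ᶠ s in 𝓝[>] 0, |Y s - x| ≤ C * s)
    (hXm : ∀ᶠ s in 𝓝[>] 0, Measurable (X s))
    (hUi : ∀ᶠ s in 𝓝[>] 0, Integrable (fun t => U (Y s, X s t)) μ)
    (hU0 : ∀ᶠ s in 𝓝[>] 0, ∫ t, U (Y s, X s t) ∂μ = 0)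
    (hZ : ∀ t, Tendsto (fun s => (X s t - x) / s) (𝓝[>] 0) (𝓝 (Z t))) :
    Tendsto (fun s => (Y s - x) / s) (𝓝[>] 0) (𝓝 (∫ t, Z t ∂μ)) := by
  have h1 := tendsto_integral_div_pow_of_isLittleO (μ := μ) (n := 1)
    (by simpa using hU) hX hY
  have h2 : Tendsto (fun s => ∫ t, (X s t - x) / s ∂μ) (𝓝[>] 0) (𝓝 (∫ t, Z t ∂μ)) := by
    refine tendsto_integral_filter_of_dominated_convergence (fun _ => C) ?_ ?_
      (integrable_const _) (ae_of_all _ hZ)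
    · filter_upwards [hXm] with s hs
      exact ((hs.sub_const x).div_const s).aestronglyMeasurable
    · filter_upwards [hX, self_mem_nhdsWithin] with s hs hs0
      have hs0 : 0 < s := hs0
      refine ae_of_all _ fun t => ?_
      rw [norm_div, Real.norm_eq_abs, Real.norm_of_nonneg hs0.le, div_le_iff₀ hs0]
      exact hs t
  have h3 := h1.add h2
  rw [zero_add] at h3
  refine h3.congr' ?_
  filter_upwards [hX, hXm, hUi, hU0, self_mem_nhdsWithin] with s hs hsm hsi hs0 hpos
  have hXi : Integrable (X s) μ := by
    refine Integrable.of_bound (C := C * s + |x|) hsm.aestronglyMeasurable (ae_of_all _ fun t => ?_)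
    have := abs_add_le (X s t - x) x
    rw [sub_add_cancel] at this
    exact this.trans (by linarith [hs t])
  have hXYi : Integrable (fun t => X s t - Y s) μ := hXi.sub (integrable_const _)
  rw [integral_sub hsi hXYi, hs0, integral_div,
    integral_sub hXi (integrable_const _), integral_sub hXi (integrable_const _)]
  simp only [integral_const, probReal_univ, one_smul, pow_one]
  ring

/-- If the integral of `w` along the curves vanishes, then so does its leading term
`c ∫ (X s - Y s) ^ n`, divided by `s ^ n`, in the limit `s → 0+`. -/
lemma coeff_mul_integral_pow_eq_zero {w : ℝ × ℝ → ℝ} {c : ℝ} {n : ℕ} {ζ : ℝ}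
    (hw : (fun p => w p - c * (p.2 - p.1) ^ n) =o[𝓝 (x, x)] fun p => (p.2 - p.1) ^ n)
    (hX : ∀ᶠ s in 𝓝[>] 0, ∀ t, |X s t - x| ≤ C * s)
    (hY : ∀ᶠ s in 𝓝[>] 0, |Y s - x| ≤ C * s)
    (hXm : ∀ᶠ s in 𝓝[>] 0, Measurable (X s))
    (hwi : ∀ᶠ s in 𝓝[>] 0, Integrable (fun t => w (Y s, X s t)) μ)
    (hw0 : ∀ᶠ s in 𝓝[>] 0, ∫ t, w (Y s, X s t) ∂μ = 0)
    (hZ : ∀ t, Tendsto (fun s => (X s t - x) / s) (𝓝[>] 0) (𝓝 (Z t)))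
    (hζ : Tendsto (fun s => (Y s - x) / s) (𝓝[>] 0) (𝓝 ζ)) :
    c * ∫ t, (Z t - ζ) ^ n ∂μ = 0 := by
  have h1 := tendsto_integral_div_pow_of_isLittleO (μ := μ) hw hX hY
  have hbd : ∀ᶠ s in 𝓝[>] 0, ∀ t, ‖((X s t - Y s) / s) ^ n‖ ≤ (2 * C) ^ n := by
    filter_upwards [hX, hY, self_mem_nhdsWithin] with s hXs hYs hs0 t
    have hs0 : 0 < s := hs0
    rw [norm_pow, norm_div, Real.norm_eq_abs, Real.norm_of_nonneg hs0.le]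
    gcongr
    rw [div_le_iff₀ hs0]
    calc |X s t - Y s| = |(X s t - x) - (Y s - x)| := by ring_nf
      _ ≤ |X s t - x| + |Y s - x| := abs_sub _ _
      _ ≤ 2 * C * s := by linarith [hXs t]
  have hmeas : ∀ᶠ s in 𝓝[>] 0, AEStronglyMeasurable (fun t => ((X s t - Y s) / s) ^ n) μ := by
    filter_upwards [hXm] with s hs
    exact (((hs.sub_const _).div_const s).pow_const n).aestronglyMeasurable
  have h2 : Tendsto (fun s => ∫ t, ((X s t - Y s) / s) ^ n ∂μ) (𝓝[>] 0)
      (𝓝 (∫ t, (Z t - ζ) ^ n ∂μ)) := by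
    refine tendsto_integral_filter_of_dominated_convergence (fun _ => (2 * C) ^ n) hmeas ?_
      (integrable_const _) (ae_of_all _ fun t => ?_)
    · filter_upwards [hbd] with s hs using ae_of_all _ hs
    · refine (((hZ t).sub hζ).pow n).congr fun s => ?_
      ring
  have h3 := h1.add (h2.const_mul c)
  rw [zero_add] at h3
  refine tendsto_nhds_unique (h3.congr' ?_) tendsto_const_nhds
  filter_upwards [hbd, hmeas, hwi, hw0, self_mem_nhdsWithin] with s hb hm hi h0 hs0
  have hs0 : s ≠ 0 := (show 0 < s from hs0).ne'
  have hpi : Integrable (fun t => ((X s t - Y s) / s) ^ n) μ :=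
    Integrable.of_bound hm _ (ae_of_all _ hb)
  have hscale : ∀ t, c * (X s t - Y s) ^ n = c * s ^ n * ((X s t - Y s) / s) ^ n := fun t => by
    rw [div_pow]; field_simp
  simp only [hscale]
  rw [integral_sub hi (hpi.const_mul _), h0, integral_const_mul]
  field_simp
  ring

end Moments

/-! ### Equality of generalized Bajraktarević means -/

section EqualMeans

variable {d : ℕ} {I : Set ℝ} {x : ℝ}

lemma isOpen_cube (hI : IsOpen I) : IsOpen (cube d I) := by
  have : cube d I = Set.pi univ fun _ => I := by
    ext; simp [cube]
  rw [this]
  exact isOpen_set_pi finite_univ fun _ _ => hI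

lemma diag_mem_cube (hx : x ∈ I) : diag d x ∈ cube d I := fun _ => hx

lemma eventually_mem_cube (hI : IsOpen I) (hx : x ∈ I) (v : Fin d → ℝ) :
    ∀ᶠ s : ℝ in 𝓝[>] 0, diag d x + s • v ∈ cube d I := by
  have hc : Tendsto (fun s : ℝ => diag d x + s • v) (𝓝[>] 0) (𝓝 (diag d x)) := by
    have : Continuous fun s : ℝ => diag d x + s • v := by fun_prop
    simpa using (this.tendsto 0).mono_left nhdsWithin_le_nhds
  exact hc.eventually ((isOpen_cube hI).mem_nhds (diag_mem_cube hx))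

variable [NeZero d]

lemma abs_sub_le_of_mem_Icc_iInf_iSup {v : Fin d → ℝ} {s y : ℝ} (hs : 0 ≤ s)
    (hy : y ∈ Icc (⨅ i, (diag d x + s • v) i) (⨆ i, (diag d x + s • v) i)) :
    |y - x| ≤ ‖v‖ * s := by
  have hv : ∀ i, |s * v i| ≤ ‖v‖ * s := fun i => by
    rw [abs_mul, abs_of_nonneg hs, mul_comm]
    exact mul_le_mul_of_nonneg_right (norm_le_pi_norm v i) hs
  have h1 : x - ‖v‖ * s ≤ ⨅ i, (diag d x + s • v) i := le_ciInf fun i => by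
    have := neg_le_of_abs_le (hv i)
    simp only [Pi.add_apply, Pi.smul_apply, smul_eq_mul, diag]
    linarith
  have h2 : ⨆ i, (diag d x + s • v) i ≤ x + ‖v‖ * s := ciSup_le fun i => by
    have := le_of_abs_le (hv i)
    simp only [Pi.add_apply, Pi.smul_apply, smul_eq_mul, diag]
    linarith
  rw [abs_le]
  constructor <;> linarith [hy.1, hy.2]

variable {T : Type*} [MeasurableSpace T] {μ : Measure T} [IsProbabilityMeasure μ]
  {m : (Fin d → ℝ) → T → ℝ} (hI : IsOpen I) (hm : IsFamilyC1 μ I m) (hx : x ∈ I)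
include hI hm

omit [NeZero d] [IsProbabilityMeasure μ] in
lemma IsFamilyC1.differentiableAt (t : T) {p : Fin d → ℝ} (hp : p ∈ cube d I) :
    DifferentiableAt ℝ (fun y => m y t) p :=
  ((hm.contDiffOn_one t).differentiableOn one_ne_zero).differentiableAt
    ((isOpen_cube hI).mem_nhds hp)

include hx

omit [IsProbabilityMeasure μ] hI in
lemma IsFamilyC1.apply_diag (t : T) : m (diag d x) t = x := by
  have := (hm.isMean t _ (diag_mem_cube hx)).2
  simp only [diag, ciInf_const, ciSup_const] at this
  exact le_antisymm this.2 this.1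

omit [IsProbabilityMeasure μ] in
lemma IsFamilyC1.abs_apply_sub_le (v : Fin d → ℝ) :
    ∀ᶠ s in 𝓝[>] (0 : ℝ), ∀ t, |m (diag d x + s • v) t - x| ≤ ‖v‖ * s := by
  filter_upwards [eventually_mem_cube hI hx v, self_mem_nhdsWithin] with s hs hs0 t
  exact abs_sub_le_of_mem_Icc_iInf_iSup (show 0 < s from hs0).le (hm.isMean t _ hs).2

omit [IsProbabilityMeasure μ] in
lemma IsFamilyC1.tendsto_slope (v : Fin d → ℝ) (t : T) :
    Tendsto (fun s : ℝ => (m (diag d x + s • v) t - x) / s) (𝓝[>] 0)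
      (𝓝 (∑ i, v i * pd i (fun y => m y t) (diag d x))) := by
  have hd := hm.differentiableAt hI t (diag_mem_cube hx)
  have h1 := (hd.hasFDerivAt.hasLineDerivAt v).tendsto_slope_zero_right
  have h2 : fderiv ℝ (fun y => m y t) (diag d x) v
      = ∑ i, v i * pd i (fun y => m y t) (diag d x) := by
    conv_lhs => rw [← Finset.univ_sum_single v, map_sum]
    refine Finset.sum_congr rfl fun i _ => ?_
    rw [pd, hd.lineDeriv_eq_fderiv, ← smul_eq_mul, ← map_smul, ← Pi.single_smul, smul_eq_mul,
      mul_one]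
  rw [← h2]
  refine h1.congr fun s => ?_
  simp only [hm.apply_diag hx, smul_eq_mul]
  ring

omit [NeZero d] [IsProbabilityMeasure μ] hI in
lemma IsFamilyC1.measurable_pd (i : Fin d) :
    Measurable fun t => pd i (fun y => m y t) (diag d x) :=
  (hm.pd_type_one _ (diag_mem_cube hx) i).1

omit [IsProbabilityMeasure μ] in
/-- The difference quotients of a mean along a unit vector are bounded by `1`, so its partial
derivatives on the diagonal are. -/
lemma IsFamilyC1.abs_pd_le (i : Fin d) (t : T) : |pd i (fun y => m y t) (diag d x)| ≤ 1 := by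
  have h1 := (hm.tendsto_slope hI hx (Pi.single i 1) t).abs
  simp only [Pi.single_apply, ite_mul, one_mul, zero_mul, Finset.sum_ite_eq', Finset.mem_univ,
    if_true] at h1
  refine le_of_tendsto h1 ?_
  filter_upwards [hm.abs_apply_sub_le hI hx (Pi.single i 1), self_mem_nhdsWithin] with s hs hs0
  have hs0 : 0 < s := hs0
  rw [abs_div, abs_of_pos hs0, div_le_iff₀ hs0]
  simpa [Pi.norm_single] using hs t

lemma IsFamilyC1.integrable_pd (i : Fin d) :
    Integrable (fun t => pd i (fun y => m y t) (diag d x)) μ :=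
  Integrable.of_bound (hm.measurable_pd hx i).aestronglyMeasurable 1
    (ae_of_all _ (hm.abs_pd_le hI hx i))

/-- The centred derivative in the direction `v` on the diagonal. -/
noncomputable def dirStar (μ : Measure T) (m : (Fin d → ℝ) → T → ℝ) (x : ℝ) (v : Fin d → ℝ)
    (t : T) : ℝ :=
  ∑ i, v i * pdStar μ m i (diag d x) t

omit hI hm hx [NeZero d] [IsProbabilityMeasure μ] in
lemma dirStar_single (i : Fin d) (t : T) :
    dirStar μ m x (Pi.single i 1) t = pdStar μ m i (diag d x) t := by
  simp [dirStar, Pi.single_apply]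

omit hI hm hx [NeZero d] [IsProbabilityMeasure μ] in
lemma dirStar_add (v w : Fin d → ℝ) (t : T) :
    dirStar μ m x (v + w) t = dirStar μ m x v t + dirStar μ m x w t := by
  simp [dirStar, add_mul, Finset.sum_add_distrib]

lemma IsFamilyC1.integrable_dirStar_pow (v : Fin d → ℝ) (n : ℕ) :
    Integrable (fun t => dirStar μ m x v t ^ n) μ := by
  have hmeas : Measurable (dirStar μ m x v) := by
    unfold dirStar pdStar
    exact Finset.measurable_sum _ fun i _ =>
      ((hm.measurable_pd hx i).sub_const _).const_mul _
  refine Integrable.of_bound (C := (∑ i, |v i| * 2) ^ n)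
    (hmeas.pow_const n).aestronglyMeasurable (ae_of_all _ fun t => ?_)
  rw [norm_pow]
  gcongr
  refine (norm_sum_le _ _).trans (Finset.sum_le_sum fun i _ => ?_)
  rw [norm_mul, Real.norm_eq_abs]
  gcongr
  have h1 := hm.abs_pd_le hI hx i
  have h2 : |∫ s, pd i (fun y => m y s) (diag d x) ∂μ| ≤ 1 := by
    simpa using norm_integral_le_of_norm_le_const (μ := μ)
      (f := fun s => pd i (fun y => m y s) (diag d x)) (ae_of_all _ h1)
  refine (abs_sub _ _).trans ?_
  linarith [h1 t]

lemma IsFamilyC1.sum_pd_sub_integral (v : Fin d → ℝ) (t : T) :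
    ∑ i, v i * pd i (fun y => m y t) (diag d x)
      - ∫ s, ∑ i, v i * pd i (fun y => m y s) (diag d x) ∂μ = dirStar μ m x v t := by
  rw [integral_finsetSum _ fun i _ => (hm.integrable_pd hI hx i).const_mul _]
  simp only [integral_const_mul, dirStar, pdStar, mul_sub, Finset.sum_sub_distrib]

variable {J : Set ℝ} {f g h k : ℝ → ℝ}

omit hx in
/-- If the two generalized Bajraktarević means agree, the difference of the normalized
determinants has integral zero along the common mean; hence so has its leading term. -/
lemma coeff_mul_integral_dirStar_pow_eq_zero (hJo : IsOpen J) (hJ : J.OrdConnected) (hJI : J ⊆ I)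
    (hxJ : x ∈ J) (hp : IsPairC 3 J f g) (hq : IsPairC 3 J h k)
    (heq : ∀ y ∈ cube d J, bajMean J f g m μ y = bajMean J h k m μ y) {c : ℝ} {n : ℕ}
    (hc : (fun p : ℝ × ℝ => normKernel h k p - normKernel f g p - c * (p.2 - p.1) ^ n)
      =o[𝓝 (x, x)] fun p => (p.2 - p.1) ^ n) (v : Fin d → ℝ) :
    c * ∫ t, dirStar μ m x v t ^ n ∂μ = 0 := by
  have hx := hJI hxJ
  have hcube := eventually_mem_cube hJo hxJ v
  set Y : ℝ → ℝ := fun s => bajMean J f g m μ (diag d x + s • v)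
  have hX := hm.abs_apply_sub_le hI hx v
  have hY : ∀ᶠ s in 𝓝[>] (0 : ℝ), |Y s - x| ≤ ‖v‖ * s := by
    filter_upwards [hcube, self_mem_nhdsWithin] with s hs hs0
    exact abs_sub_le_of_mem_Icc_iInf_iSup (show 0 < s from hs0).le
      (bajMean_spec hJo hJ hJI hp.chebyshev hm.toIsMeasurableFamily hs).1
  have hXm : ∀ᶠ s in 𝓝[>] (0 : ℝ), Measurable (m (diag d x + s • v)) := by
    filter_upwards [hcube] with s hs using hm.measurable _ fun i => hJI (hs i)
  have hker : ∀ {f' g' : ℝ → ℝ}, IsPairC 3 J f' g' →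
      (∀ y ∈ cube d J, bajMean J f g m μ y = bajMean J f' g' m μ y) →
      ∀ᶠ s in 𝓝[>] (0 : ℝ),
        Integrable (fun t => normKernel f' g' (Y s, m (diag d x + s • v) t)) μ ∧
        ∫ t, normKernel f' g' (Y s, m (diag d x + s • v) t) ∂μ = 0 := by
    intro f' g' hp' heq'
    filter_upwards [hcube] with s hs
    have hsI : diag d x + s • v ∈ cube d I := fun i => hJI (hs i)
    have hspec := bajMean_spec (μ := μ) hJo hJ hJI hp'.chebyshev hm.toIsMeasurableFamily hs
    have hi := (hp'.chebyshev.mono (Icc_iInf_iSup_subset hJ hs)).integrable_chebDet (μ := μ)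
      (hm.measurable _ hsI) (fun t => (hm.isMean t _ hsI).2) (Y s)
    refine ⟨hi.div_const (wronski f' g' (Y s)), ?_⟩
    simp only [normKernel, integral_div]
    rw [show Y s = bajMean J f' g' m μ (diag d x + s • v) from heq' _ hs, hspec.2, zero_div]
  have hf := hker hp fun _ _ => rfl
  have hh := hker hq heq
  have hslope := tendsto_mean_slope (hp.normKernel_sub_isLittleO hJo hxJ) hX hY hXm
    (hf.mono fun _ h => h.1) (hf.mono fun _ h => h.2) (hm.tendsto_slope hI hx v)
  have hfin := coeff_mul_integral_pow_eq_zero (w := fun p => normKernel h k p - normKernel f g p)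
    hc hX hY hXm ((hh.and hf).mono fun _ h => h.1.1.sub h.2.1)
    ((hh.and hf).mono fun _ h => by
      rw [integral_sub h.1.1 h.2.1, h.1.2, h.2.2, sub_zero])
    (hm.tendsto_slope hI hx v) hslope
  simpa only [hm.sum_pd_sub_integral hI hx] using hfin

/-- Some centred partial derivative has a positive second moment. -/
lemma exists_integral_dirStar_sq_ne_zero
    (hnd : μ {t | ∀ i, pdStar μ m i (diag d x) t = 0} < 1) :
    ∃ v, ∫ t, dirStar μ m x v t ^ 2 ∂μ ≠ 0 := by
  by_contra! hall
  refine hnd.ne ?_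
  have hae : ∀ᵐ t ∂μ, ∀ i, pdStar μ m i (diag d x) t = 0 := by
    rw [ae_all_iff]
    intro i
    have h1 := (integral_eq_zero_iff_of_nonneg (fun t => sq_nonneg _)
      (hm.integrable_dirStar_pow hI hx (Pi.single i 1) 2)).1 (hall (Pi.single i 1))
    filter_upwards [h1] with t ht
    rw [← dirStar_single]
    exact pow_eq_zero_iff two_ne_zero |>.1 ht
  rw [← prob_compl_eq_zero_iff₀]
  · exact hae
  · exact NullMeasurableSet.of_compl (NullMeasurableSet.of_null hae)

/-- Polarization: the third moments of the directional derivatives determine the mixed ones. -/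
lemma exists_integral_dirStar_cube_ne_zero {i j l : Fin d}
    (h3 : ∫ t, pdStar μ m i (diag d x) t * pdStar μ m j (diag d x) t *
      pdStar μ m l (diag d x) t ∂μ ≠ 0) :
    ∃ v, ∫ t, dirStar μ m x v t ^ 3 ∂μ ≠ 0 := by
  by_contra! hall
  refine h3 ?_
  have hint := fun v => hm.integrable_dirStar_pow hI hx v 3
  set e : Fin d → Fin d → ℝ := fun i => Pi.single i 1 with he
  have hpol : ∀ t, pdStar μ m i (diag d x) t * pdStar μ m j (diag d x) t *
      pdStar μ m l (diag d x) t = (dirStar μ m x (e i + e j + e l) t ^ 3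
        - dirStar μ m x (e i + e j) t ^ 3 - dirStar μ m x (e i + e l) t ^ 3
        - dirStar μ m x (e j + e l) t ^ 3 + dirStar μ m x (e i) t ^ 3
        + dirStar μ m x (e j) t ^ 3 + dirStar μ m x (e l) t ^ 3) / 6 := by
    intro t
    simp only [dirStar_add, he, dirStar_single]
    ring
  have hsub : ∀ {F G : T → ℝ}, (Integrable F μ ∧ ∫ t, F t ∂μ = 0) →
      (Integrable G μ ∧ ∫ t, G t ∂μ = 0) →
      Integrable (fun t => F t - G t) μ ∧ ∫ t, F t - G t ∂μ = 0 := fun hF hG =>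
    ⟨hF.1.sub hG.1, by rw [integral_sub hF.1 hG.1, hF.2, hG.2, sub_zero]⟩
  have hadd : ∀ {F G : T → ℝ}, (Integrable F μ ∧ ∫ t, F t ∂μ = 0) →
      (Integrable G μ ∧ ∫ t, G t ∂μ = 0) →
      Integrable (fun t => F t + G t) μ ∧ ∫ t, F t + G t ∂μ = 0 := fun hF hG =>
    ⟨hF.1.add hG.1, by rw [integral_add hF.1 hG.1, hF.2, hG.2, add_zero]⟩
  have hQ : ∀ v, Integrable (fun t => dirStar μ m x v t ^ 3) μ ∧
      ∫ t, dirStar μ m x v t ^ 3 ∂μ = 0 := fun v => ⟨hint v, hall v⟩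
  simp only [hpol]
  rw [integral_div, (hadd (hadd (hadd (hsub (hsub (hsub (hQ (e i + e j + e l)) (hQ (e i + e j)))
    (hQ (e i + e l))) (hQ (e j + e l))) (hQ (e i))) (hQ (e j))) (hQ (e l))).2, zero_div]

omit hx in
/-- Equality of generalized Bajraktarević means forces equality of the invariants `Φ` and `Ψ`:
the second moments give `Φ`, and then the third moments give `Ψ`. -/
theorem PhiFun_PsiFun_eq_of_bajMean_eq (hJo : IsOpen J) (hJ : J.OrdConnected) (hJI : J ⊆ I)
    (hp : IsPairC 3 J f g) (hq : IsPairC 3 J h k)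
    (heq : ∀ y ∈ cube d J, bajMean J f g m μ y = bajMean J h k m μ y)
    (hnd : ∀ y ∈ J, μ {t | ∀ i, pdStar μ m i (diag d y) t = 0} < 1)
    (hthird : ∀ y ∈ J, ∃ i j l : Fin d, ∫ t, pdStar μ m i (diag d y) t *
      pdStar μ m j (diag d y) t * pdStar μ m l (diag d y) t ∂μ ≠ 0) (hx : x ∈ J) :
    PhiFun f g x = PhiFun h k x ∧ PsiFun f g x = PsiFun h k x := by
  have hΦ : ∀ y ∈ J, PhiFun f g y = PhiFun h k y := by
    intro y hy
    obtain ⟨v, hv⟩ := exists_integral_dirStar_sq_ne_zero hI hm (hJI hy) (hnd y hy)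
    have := (mul_eq_zero.1 (coeff_mul_integral_dirStar_pow_eq_zero hI hm hJo hJ hJI hy hp hq heq
      (normKernel_sub_normKernel_two hJo hp hy hq) v)).resolve_right hv
    linarith
  obtain ⟨i, j, l, h3⟩ := hthird x hx
  obtain ⟨v, hv⟩ := exists_integral_dirStar_cube_ne_zero hI hm (hJI hx) h3
  have := (mul_eq_zero.1 (coeff_mul_integral_dirStar_pow_eq_zero hI hm hJo hJ hJI hx hp hq heq
    (normKernel_sub_normKernel_three hJo hp hx hq hΦ) v)).resolve_right hv
  exact ⟨hΦ x hx, by linarith⟩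

omit [NeZero d] [IsProbabilityMeasure μ] hx in
/-- The partial derivatives of a homogeneous family are homogeneous of degree zero, so they are
constant along the diagonal. -/
lemma pd_diag_eq_of_homogeneous (hhom : ∀ t, IsHomogeneousOn I fun x => m x t)
    (hIpos : I ⊆ Ioi 0) {y : ℝ} (hx : x ∈ I) (hy : y ∈ I) (i : Fin d) (t : T) :
    pd i (fun z => m z t) (diag d y) = pd i (fun z => m z t) (diag d x) := by
  set c := y / x with hc
  have hx0 : 0 < x := hIpos hx
  have hcx : c * x = y := div_mul_cancel₀ _ hx0.ne'
  have hc0 : c ≠ 0 := (div_pos (hIpos hy) hx0).ne'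
  have hdiag : c • diag d x = diag d y := by
    funext i; simpa [diag] using hcx
  have hev : (fun z => m (c • z) t) =ᶠ[𝓝 (diag d x)] fun z => c * m z t := by
    have h1 : IsOpen (scaledInter I c) := hI.inter (hI.preimage (continuous_const_mul c))
    have h2 : x ∈ scaledInter I c := ⟨hx, by rwa [hcx]⟩
    filter_upwards [(isOpen_cube h1).mem_nhds (diag_mem_cube h2)] with z hz
    exact hhom t c (div_mem_div hy hx) z hz
  have hdx := hm.differentiableAt hI t (diag_mem_cube hx)
  have hdy := hm.differentiableAt hI t (diag_mem_cube hy)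
  have h1 : HasFDerivAt (fun z => m (c • z) t)
      ((fderiv ℝ (fun z => m z t) (diag d y)).comp (c • ContinuousLinearMap.id ℝ (Fin d → ℝ)))
      (diag d x) := by
    have h0 := hdy.hasFDerivAt
    rw [← hdiag] at h0 ⊢
    exact h0.comp (diag d x) ((hasFDerivAt_id (diag d x)).const_smul c)
  have h2 := (hdx.hasFDerivAt.const_mul c).congr_of_eventuallyEq hev
  have h3 := congrArg (fun L => L (Pi.single i 1)) (h1.unique h2)
  simp only [ContinuousLinearMap.comp_apply, _root_.smul_apply,
    ContinuousLinearMap.id_apply, map_smul, smul_eq_mul] at h3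
  rw [pd, pd, hdx.lineDeriv_eq_fderiv, hdy.lineDeriv_eq_fderiv]
  exact mul_left_cancel₀ hc0 h3

omit [NeZero d] [IsProbabilityMeasure μ] hx in
lemma pdStar_diag_eq_of_homogeneous (hhom : ∀ t, IsHomogeneousOn I fun x => m x t)
    (hIpos : I ⊆ Ioi 0) {y : ℝ} (hx : x ∈ I) (hy : y ∈ I) (i : Fin d) (t : T) :
    pdStar μ m i (diag d y) t = pdStar μ m i (diag d x) t := by
  simp only [pdStar, pd_diag_eq_of_homogeneous hI hm hhom hIpos hx hy]

end EqualMeans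

/-! ### Second order linear equations -/

section LinearODE

/-- `y` is a twice differentiable solution of `y'' = P y' + Q y` on `J`. -/
def IsLinearSolution (J : Set ℝ) (P Q y : ℝ → ℝ) : Prop :=
  ∀ x ∈ J, HasDerivAt y (deriv y x) x ∧ HasDerivAt (deriv y) (P x * deriv y x + Q x * y x) x

variable {J : Set ℝ} {P Q y f g h k : ℝ → ℝ}

lemma IsLinearSolution.hasDerivAt_wronski (hf : IsLinearSolution J P Q f)
    (hg : IsLinearSolution J P Q g) {x : ℝ} (hx : x ∈ J) :
    HasDerivAt (wronski f g) (P x * wronski f g x) x := by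
  obtain ⟨f1, f2⟩ := hf x hx
  obtain ⟨g1, g2⟩ := hg x hx
  refine ((f2.mul g1).sub (f1.mul g2)).congr_deriv ?_
  unfold wronski
  ring

/-- All Wronskians of solutions of one equation satisfy the same first order equation, so their
quotients are constant. -/
lemma exists_wronski_eq_const_mul (hJo : IsOpen J) (hJ : J.OrdConnected) {u v : ℝ → ℝ}
    (hf : IsLinearSolution J P Q f) (hg : IsLinearSolution J P Q g)
    (hu : IsLinearSolution J P Q u) (hv : IsLinearSolution J P Q v)
    (hW : ∀ x ∈ J, wronski f g x ≠ 0) : ∃ c, ∀ x ∈ J, wronski u v x = c * wronski f g x := by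
  have hd : ∀ x ∈ J, HasDerivAt (fun x => wronski u v x / wronski f g x) 0 x := fun x hx => by
    refine ((hu.hasDerivAt_wronski hv hx).div (hf.hasDerivAt_wronski hg hx)
      (hW x hx)).congr_deriv ?_
    ring
  obtain ⟨c, hc⟩ := hJo.exists_is_const_of_deriv_eq_zero hJ.isPreconnected
    (fun x hx => (hd x hx).differentiableAt.differentiableWithinAt) fun x hx => (hd x hx).deriv
  refine ⟨c, fun x hx => ?_⟩
  rw [← hc x hx, div_mul_cancel₀ _ (hW x hx)]

lemma IsLinearSolution.exists_eq_linear_combination (hJo : IsOpen J) (hJ : J.OrdConnected)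
    (hy : IsLinearSolution J P Q y) (hf : IsLinearSolution J P Q f)
    (hg : IsLinearSolution J P Q g) (hW : ∀ x ∈ J, wronski f g x ≠ 0) :
    ∃ a b : ℝ, ∀ x ∈ J, y x = a * f x + b * g x := by
  obtain ⟨a, ha⟩ := exists_wronski_eq_const_mul hJo hJ hf hg hy hg hW
  obtain ⟨b, hb⟩ := exists_wronski_eq_const_mul hJo hJ hf hg hf hy hW
  refine ⟨a, b, fun x hx => mul_right_cancel₀ (hW x hx) ?_⟩
  have : y x * wronski f g x = wronski y g x * f x + wronski f y x * g x := by
    unfold wronski; ring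
  rw [this, ha x hx, hb x hx]
  ring

lemma pairsEquivalent_of_isLinearSolution (hJo : IsOpen J) (hJ : J.OrdConnected)
    (hne : J.Nonempty) (hcheb : IsChebyshev J f g) (hf : IsLinearSolution J P Q f)
    (hg : IsLinearSolution J P Q g) (hh : IsLinearSolution J P Q h)
    (hk : IsLinearSolution J P Q k) (hW : ∀ x ∈ J, wronski h k x ≠ 0) :
    PairsEquivalent J f g h k := by
  obtain ⟨α, β, hfe⟩ := hf.exists_eq_linear_combination hJo hJ hh hk hW
  obtain ⟨γ, δ, hge⟩ := hg.exists_eq_linear_combination hJo hJ hh hk hW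
  refine ⟨α, β, γ, δ, fun h0 => ?_, fun x hx => ⟨hfe x hx, hge x hx⟩⟩
  obtain ⟨x, hx⟩ := hne
  obtain ⟨y, hyx, hy⟩ : ∃ y, x < y ∧ y ∈ J := by
    obtain ⟨u, hu, huJ⟩ := exists_Ico_subset_of_mem_nhds (hJo.mem_nhds hx) ⟨x + 1, by linarith⟩
    obtain ⟨y, h1, h2⟩ := exists_between hu
    exact ⟨y, h1, huJ ⟨h1.le, h2⟩⟩
  refine hcheb.det_ne_zero x hx y hy hyx.ne ?_
  unfold chebDet
  rw [hfe x hx, hfe y hy, hge x hx, hge y hy]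
  linear_combination (h x * k y - h y * k x) * h0

end LinearODE

/-! ### Equivalent pairs -/

section Equivalence

variable {J : Set ℝ} {f g h k : ℝ → ℝ}

lemma PairsEquivalent.exists_chebDet_eq (he : PairsEquivalent J f g h k) :
    ∃ c ≠ 0, ∀ x ∈ J, ∀ y ∈ J, chebDet f g x y = c * chebDet h k x y := by
  obtain ⟨α, β, γ, δ, h0, he⟩ := he
  refine ⟨_, h0, fun x hx y hy => ?_⟩
  unfold chebDet
  rw [(he x hx).1, (he x hx).2, (he y hy).1, (he y hy).2]
  ring

lemma IsChebyshev.of_pairsEquivalent (hfg : IsChebyshev J f g) (he : PairsEquivalent J f g h k)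
    (hh : ContinuousOn h J) (hk : ContinuousOn k J) : IsChebyshev J h k where
  continuousOn_left := hh
  continuousOn_right := hk
  det_ne_zero x hx y hy hxy h0 := by
    obtain ⟨c, -, hc⟩ := he.exists_chebDet_eq
    refine hfg.det_ne_zero x hx y hy hxy ?_
    rw [hc x hx y hy, h0, mul_zero]

variable {T : Type*} [MeasurableSpace T] {μ : Measure T} {d : ℕ} [NeZero d] {I : Set ℝ}
  {m : (Fin d → ℝ) → T → ℝ}

/-- The determinants of equivalent pairs differ by a nonzero factor, so both means are given by the
same equation. -/
lemma bajMean_eq_of_pairsEquivalent (hJ : J.OrdConnected) (hJI : J ⊆ I)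
    (hm : IsMeasurableFamily I m) (he : PairsEquivalent J f g h k) {x : Fin d → ℝ}
    (hx : x ∈ cube d J) : bajMean J f g m μ x = bajMean J h k m μ x := by
  obtain ⟨c, hc0, hc⟩ := he.exists_chebDet_eq
  unfold bajMean
  congr 1
  funext y
  refine propext (and_congr_right fun hy => ?_)
  have hmJ : ∀ t, m x t ∈ J := fun t =>
    Icc_iInf_iSup_subset hJ hx (hm.isMean t x fun i => hJI (hx i)).2
  simp only [fun t => hc (m x t) (hmJ t) y hy, integral_const_mul, mul_eq_zero, hc0, false_or]

/-- The mean on `I` stays between the extreme entries of `x`, hence in every subinterval containing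
them. -/
lemma bajMean_restrict [IsProbabilityMeasure μ] (hIo : IsOpen I) (hI : I.OrdConnected)
    (hJo : IsOpen J) (hJ : J.OrdConnected) (hJI : J ⊆ I) (hfg : IsChebyshev I f g)
    (hm : IsMeasurableFamily I m) {x : Fin d → ℝ} (hx : x ∈ cube d J) :
    bajMean J f g m μ x = bajMean I f g m μ x := by
  have hspec := bajMean_spec (μ := μ) hIo hI Subset.rfl hfg hm fun i => hJI (hx i)
  exact bajMean_eq hJo hJ hJI (hfg.mono hJI) hm hx (Icc_iInf_iSup_subset hJ hx hspec.1) hspec.2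

end Equivalence

/-! ### Rescaling -/

section Scaling

variable {I : Set ℝ} {f g : ℝ → ℝ} {l : ℝ}

lemma pos_of_mem_div (hIpos : I ⊆ Ioi 0) (hl : l ∈ I / I) : 0 < l := by
  obtain ⟨a, ha, b, hb, rfl⟩ := hl
  exact div_pos (hIpos ha) (hIpos hb)

lemma scaledInter_nonempty (hIpos : I ⊆ Ioi 0) (hl : l ∈ I / I) : (scaledInter I l).Nonempty := by
  obtain ⟨a, ha, b, hb, rfl⟩ := hl
  exact ⟨b, hb, by rwa [div_mul_cancel₀ _ (show 0 < b from hIpos hb).ne']⟩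

lemma isOpen_scaledInter (hI : IsOpen I) : IsOpen (scaledInter I l) :=
  hI.inter (hI.preimage (continuous_const_mul l))

lemma ordConnected_scaledInter (hI : I.OrdConnected) (hl : 0 < l) :
    (scaledInter I l).OrdConnected := by
  refine ⟨fun x hx y hy z hz => ⟨hI.out hx.1 hy.1 hz, hI.out hx.2 hy.2 ⟨?_, ?_⟩⟩⟩
  · exact mul_le_mul_of_nonneg_left hz.1 hl.le
  · exact mul_le_mul_of_nonneg_left hz.2 hl.le

lemma scaledInter_subset : scaledInter I l ⊆ I := fun _ hx => hx.1

lemma deriv_rescale (l : ℝ) (f : ℝ → ℝ) :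
    deriv (rescale l f) = fun x => l * deriv f (l * x) := by
  funext x
  exact deriv_comp_mul_left l f x

lemma deriv_deriv_rescale (l : ℝ) (f : ℝ → ℝ) :
    deriv (deriv (rescale l f)) = fun x => l ^ 2 * deriv (deriv f) (l * x) := by
  have : deriv (rescale l f) = fun x => l * rescale l (deriv f) x := deriv_rescale l f
  funext x
  rw [this, deriv_const_mul_field, deriv_rescale]
  ring

lemma wronski_rescale (x : ℝ) :
    wronski (rescale l f) (rescale l g) x = l * wronski f g (l * x) := by
  simp only [wronski, deriv_rescale, rescale]
  ring

lemma PhiFun_rescale (hl : l ≠ 0) (x : ℝ) :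
    PhiFun (rescale l f) (rescale l g) x = l * PhiFun f g (l * x) := by
  simp only [PhiFun, wronski_rescale, deriv_deriv_rescale, rescale]
  rw [mul_div_assoc', ← mul_div_mul_left _ (wronski f g (l * x)) hl]
  congr 1
  ring

lemma PsiFun_rescale (hl : l ≠ 0) (x : ℝ) :
    PsiFun (rescale l f) (rescale l g) x = l ^ 2 * PsiFun f g (l * x) := by
  simp only [PsiFun, wronski_rescale, deriv_deriv_rescale]
  simp only [deriv_rescale]
  rw [mul_neg, mul_div_assoc', ← mul_div_mul_left _ (wronski f g (l * x)) hl]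
  congr 2
  ring

lemma IsPairC.rescale {n : ℕ} (h : IsPairC n I f g) (hl : l ≠ 0) :
    IsPairC n (scaledInter I l) (rescale l f) (rescale l g) where
  chebyshev :=
    { continuousOn_left := h.chebyshev.continuousOn_left.comp
        (continuous_const_mul l).continuousOn fun _ hx => hx.2
      continuousOn_right := h.chebyshev.continuousOn_right.comp
        (continuous_const_mul l).continuousOn fun _ hx => hx.2
      det_ne_zero := fun x hx y hy hxy => h.chebyshev.det_ne_zero (l * x) hx.2 (l * y) hy.2
        fun he => hxy (mul_left_cancel₀ hl he) }
  contDiffOn_left := h.contDiffOn_left.comp (contDiff_const.mul contDiff_id).contDiffOn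
    fun _ hx => hx.2
  contDiffOn_right := h.contDiffOn_right.comp (contDiff_const.mul contDiff_id).contDiffOn
    fun _ hx => hx.2
  wronski_ne_zero x hx := by
    rw [wronski_rescale]
    exact mul_ne_zero hl (h.wronski_ne_zero _ hx.2)

lemma IsPairC.mono {n : ℕ} {J : Set ℝ} (h : IsPairC n I f g) (hJ : J ⊆ I) : IsPairC n J f g where
  chebyshev := h.chebyshev.mono hJ
  contDiffOn_left := h.contDiffOn_left.mono hJ
  contDiffOn_right := h.contDiffOn_right.mono hJ
  wronski_ne_zero x hx := h.wronski_ne_zero x (hJ hx)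

lemma SolvesCauchyEuler.rescale {α β : ℝ} (h : SolvesCauchyEuler I α β f) (hl : l ≠ 0) :
    SolvesCauchyEuler (scaledInter I l) α β (rescale l f) := by
  intro x hx
  rw [deriv_deriv_rescale, deriv_rescale]
  simp only [GenMeans.rescale]
  rw [h _ hx.2]
  rcases eq_or_ne x 0 with rfl | hx0
  · simp
  · field_simp

/-- By Cramer's rule, `f` and `g` solve the linear equation with coefficients `Φ` and `Ψ`. -/
lemma deriv_deriv_eq_PhiFun_PsiFun {x : ℝ} (hW : wronski f g x ≠ 0) :
    deriv (deriv f) x = PhiFun f g x * deriv f x + PsiFun f g x * f x ∧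
      deriv (deriv g) x = PhiFun f g x * deriv g x + PsiFun f g x * g x := by
  unfold PhiFun PsiFun
  constructor <;> field_simp <;> unfold wronski <;> ring

lemma IsPairC.isLinearSolution (hIo : IsOpen I) (h : IsPairC 3 I f g) {α β : ℝ}
    (hf : SolvesCauchyEuler I α β f) (hg : SolvesCauchyEuler I α β g) :
    IsLinearSolution I (fun x => α / x) (fun x => β / x ^ 2) f ∧
      IsLinearSolution I (fun x => α / x) (fun x => β / x ^ 2) g := by
  constructor
  · intro x hx
    have hd := h.hasDerivAts hIo hx
    exact ⟨hd.1.1, hf x hx ▸ hd.2.1.1⟩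
  · intro x hx
    have hd := h.hasDerivAts hIo hx
    exact ⟨hd.1.2, hg x hx ▸ hd.2.1.2⟩

lemma IsPairC.pairsEquivalent_rescale (hIo : IsOpen I) (hI : I.OrdConnected)
    (hIpos : I ⊆ Ioi 0) (h : IsPairC 3 I f g) {α β : ℝ} (hf : SolvesCauchyEuler I α β f)
    (hg : SolvesCauchyEuler I α β g) (hl : l ∈ I / I) :
    PairsEquivalent (scaledInter I l) f g (GenMeans.rescale l f) (GenMeans.rescale l g) := by
  have hl0 := pos_of_mem_div hIpos hl
  have h1 := (h.mono (scaledInter_subset (l := l))).isLinearSolution (isOpen_scaledInter hIo)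
    (fun x hx => hf x hx.1) (fun x hx => hg x hx.1)
  have h2 := (h.rescale hl0.ne').isLinearSolution (isOpen_scaledInter hIo)
    (hf.rescale hl0.ne') (hg.rescale hl0.ne')
  exact pairsEquivalent_of_isLinearSolution (isOpen_scaledInter hIo)
    (ordConnected_scaledInter hI hl0) (scaledInter_nonempty hIpos hl)
    (h.chebyshev.mono scaledInter_subset) h1.1 h1.2 h2.1 h2.2 (h.rescale hl0.ne').wronski_ne_zero

variable {T : Type*} [MeasurableSpace T] {μ : Measure T} [IsProbabilityMeasure μ]
  {d : ℕ} [NeZero d] {m : (Fin d → ℝ) → T → ℝ}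

/-- Replacing `x` by `l x` amounts to replacing the generators by their rescalings, as the family
`m` is homogeneous. -/
lemma bajMean_smul (hIo : IsOpen I) (hI : I.OrdConnected) (hIpos : I ⊆ Ioi 0)
    (h : IsPairC 3 I f g) (hm : IsMeasurableFamily I m)
    (hhom : ∀ t, IsHomogeneousOn I fun x => m x t) (hl : l ∈ I / I) {x : Fin d → ℝ}
    (hx : x ∈ cube d (scaledInter I l)) :
    bajMean I f g m μ (l • x) =
      l * bajMean (scaledInter I l) (rescale l f) (rescale l g) m μ x := by
  have hl0 := pos_of_mem_div hIpos hl
  have hJo := isOpen_scaledInter (l := l) hIo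
  have hJ := ordConnected_scaledInter hI hl0
  have hc := (h.rescale hl0.ne').chebyshev
  have hlx : l • x ∈ cube d I := fun i => (hx i).2
  refine bajMean_eq hIo hI Subset.rfl h.chebyshev hm hlx
    (bajMean_mem hJo hJ scaledInter_subset hc hm hx).2 ?_
  rw [← (bajMean_spec (μ := μ) hJo hJ scaledInter_subset hc hm hx).2]
  refine integral_congr_ae (ae_of_all _ fun t => ?_)
  have : m (l • x) t = l * m x t := hhom t l hl x hx
  simp only [this, chebDet, rescale]

lemma isHomogeneousOn_bajMean_iff (hIo : IsOpen I) (hI : I.OrdConnected) (hIpos : I ⊆ Ioi 0)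
    (h : IsPairC 3 I f g) (hm : IsMeasurableFamily I m)
    (hhom : ∀ t, IsHomogeneousOn I fun x => m x t) :
    IsHomogeneousOn I (bajMean I f g m μ) ↔ ∀ l ∈ I / I, ∀ x ∈ cube d (scaledInter I l),
      bajMean I f g m μ x =
        bajMean (scaledInter I l) (rescale l f) (rescale l g) m μ x := by
  refine forall₂_congr fun l hl => forall₂_congr fun x hx => ?_
  rw [bajMean_smul hIo hI hIpos h hm hhom hl hx, mul_right_inj' (pos_of_mem_div hIpos hl).ne']
  exact eq_comm

lemma bajMean_eq_rescale_of_pairsEquivalent (hIo : IsOpen I) (hI : I.OrdConnected)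
    (hIpos : I ⊆ Ioi 0) (h : IsPairC 3 I f g) (hm : IsMeasurableFamily I m) (hl : l ∈ I / I)
    (he : PairsEquivalent (scaledInter I l) f g (rescale l f) (rescale l g)) {x : Fin d → ℝ}
    (hx : x ∈ cube d (scaledInter I l)) :
    bajMean I f g m μ x = bajMean (scaledInter I l) (rescale l f) (rescale l g) m μ x := by
  have hJ := ordConnected_scaledInter hI (pos_of_mem_div hIpos hl)
  rw [← bajMean_restrict hIo hI (isOpen_scaledInter hIo) hJ scaledInter_subset h.chebyshev hm hx,
    bajMean_eq_of_pairsEquivalent hJ scaledInter_subset hm he hx]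

/-- A pair solving a Cauchy–Euler equation generates a homogeneous mean, because its rescalings
solve the same equation. -/
lemma isHomogeneousOn_bajMean_of_solvesCauchyEuler (hIo : IsOpen I) (hI : I.OrdConnected)
    (hIpos : I ⊆ Ioi 0) (h : IsPairC 3 I f g) (hm : IsMeasurableFamily I m)
    (hhom : ∀ t, IsHomogeneousOn I fun x => m x t) {α β : ℝ} (hf : SolvesCauchyEuler I α β f)
    (hg : SolvesCauchyEuler I α β g) : IsHomogeneousOn I (bajMean I f g m μ) :=
  (isHomogeneousOn_bajMean_iff hIo hI hIpos h hm hhom).2 fun _ hl _ hx =>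
    bajMean_eq_rescale_of_pairsEquivalent hIo hI hIpos h hm hl
      (h.pairsEquivalent_rescale hIo hI hIpos hf hg hl) hx

end Scaling

/-! ### The Gini pairs -/

section Gini

variable {I : Set ℝ}

/-- In the variable `s = log x`, the Gini pair with parameters `p, q` is a fundamental system of
the equation with constant coefficients whose characteristic roots are `p` and `q`. -/
lemma exists_giniPair_eq_comp_log {p q : ℂ} (hsum : (p + q).im = 0) (hprod : (p * q).im = 0) :
    ∃ φ φ' ψ ψ' : ℝ → ℝ, (ContDiff ℝ 3 φ ∧ ContDiff ℝ 3 ψ) ∧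
      (∀ x > 0, giniF p q x = φ (Real.log x) ∧ giniG p q x = ψ (Real.log x)) ∧
      (∀ s, HasDerivAt φ (φ' s) s ∧ HasDerivAt ψ (ψ' s) s ∧
        HasDerivAt φ' ((p + q).re * φ' s - (p * q).re * φ s) s ∧
        HasDerivAt ψ' ((p + q).re * ψ' s - (p * q).re * ψ s) s) ∧
      ∀ s, φ' s * ψ s - φ s * ψ' s ≠ 0 := by
  have hlin : ∀ c s : ℝ, HasDerivAt (fun s => c * s) c s := fun c s => by
    simpa using (hasDerivAt_id s).const_mul c
  have hexp : ∀ c s : ℝ, HasDerivAt (fun s => Real.exp (c * s)) (Real.exp (c * s) * c) s :=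
    fun c s => (hlin c s).exp
  have hpow : ∀ c : ℝ, ∀ x > 0, x ^ c = Real.exp (c * Real.log x) := fun c x hx => by
    rw [Real.rpow_def_of_pos hx, mul_comm]
  rw [Complex.add_im] at hsum
  rw [Complex.mul_im] at hprod
  by_cases hp : p.im = 0
  · have hq : q.im = 0 := by linarith
    by_cases hpq : p = q
    · subst hpq
      refine ⟨fun s => Real.exp (p.re * s) * s,
        fun s => Real.exp (p.re * s) * (p.re * s + 1), fun s => Real.exp (p.re * s),
        fun s => Real.exp (p.re * s) * p.re, ⟨by fun_prop, by fun_prop⟩, fun x hx => ?_,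
        fun s => ⟨?_, hexp _ s, ?_, ?_⟩, fun s => ?_⟩
      · simp [giniF, giniG, hp, hpow _ x hx]
      · exact ((hexp p.re s).mul (hasDerivAt_id s)).congr_deriv (by simp only [id]; ring)
      · refine ((hexp p.re s).mul ((hlin p.re s).add_const 1)).congr_deriv ?_
        simp only [Complex.add_re, Complex.mul_re, hp]; ring
      · refine ((hexp p.re s).mul_const p.re).congr_deriv ?_
        simp only [Complex.add_re, Complex.mul_re, hp]; ring
      · have : Real.exp (p.re * s) * (p.re * s + 1) * Real.exp (p.re * s)
            - Real.exp (p.re * s) * s * (Real.exp (p.re * s) * p.re)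
            = Real.exp (p.re * s) ^ 2 := by ring
        rw [this]
        positivity
    · have hre : p.re - q.re ≠ 0 := fun h => hpq (Complex.ext (by linarith) (by rw [hp, hq]))
      refine ⟨fun s => Real.exp (p.re * s), fun s => Real.exp (p.re * s) * p.re,
        fun s => Real.exp (q.re * s), fun s => Real.exp (q.re * s) * q.re,
        ⟨by fun_prop, by fun_prop⟩, fun x hx => ?_, fun s => ⟨hexp _ s, hexp _ s, ?_, ?_⟩,
        fun s => ?_⟩
      · simp [giniF, giniG, hp, hpq, hpow _ x hx]
      · refine ((hexp p.re s).mul_const p.re).congr_deriv ?_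
        simp only [Complex.add_re, Complex.mul_re, hp]; ring
      · refine ((hexp q.re s).mul_const q.re).congr_deriv ?_
        simp only [Complex.add_re, Complex.mul_re, hp]; ring
      · have : Real.exp (p.re * s) * p.re * Real.exp (q.re * s)
            - Real.exp (p.re * s) * (Real.exp (q.re * s) * q.re)
            = (p.re - q.re) * (Real.exp (p.re * s) * Real.exp (q.re * s)) := by ring
        rw [this]
        exact mul_ne_zero hre (by positivity)
  · have hq : q.im = -p.im := by linarith
    have hqre : q.re = p.re := by
      rw [hq] at hprod
      exact mul_left_cancel₀ hp (by linarith)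
    have hsin : ∀ s, HasDerivAt (fun s => Real.sin (p.im * s)) (Real.cos (p.im * s) * p.im) s :=
      fun s => (hlin p.im s).sin
    have hcos : ∀ s, HasDerivAt (fun s => Real.cos (p.im * s)) (-Real.sin (p.im * s) * p.im) s :=
      fun s => (hlin p.im s).cos
    refine ⟨fun s => Real.exp (p.re * s) * Real.sin (p.im * s),
      fun s => Real.exp (p.re * s) *
        (p.re * Real.sin (p.im * s) + p.im * Real.cos (p.im * s)),
      fun s => Real.exp (p.re * s) * Real.cos (p.im * s),
      fun s => Real.exp (p.re * s) *
        (p.re * Real.cos (p.im * s) - p.im * Real.sin (p.im * s)),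
      ⟨by fun_prop, by fun_prop⟩, fun x hx => ?_, fun s => ⟨?_, ?_, ?_, ?_⟩, fun s => ?_⟩
    · simp [giniF, giniG, hp, hpow _ x hx]
    · exact ((hexp p.re s).mul (hsin s)).congr_deriv (by ring)
    · exact ((hexp p.re s).mul (hcos s)).congr_deriv (by ring)
    · refine ((hexp p.re s).mul (((hsin s).const_mul p.re).add
        ((hcos s).const_mul p.im))).congr_deriv ?_
      simp only [Complex.add_re, Complex.mul_re, hq, hqre, Pi.add_apply]; ring
    · refine ((hexp p.re s).mul (((hcos s).const_mul p.re).sub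
        ((hsin s).const_mul p.im))).congr_deriv ?_
      simp only [Complex.add_re, Complex.mul_re, hq, hqre, Pi.sub_apply]; ring
    · have h1 := Real.sin_sq_add_cos_sq (p.im * s)
      have : Real.exp (p.re * s) * (p.re * Real.sin (p.im * s) + p.im * Real.cos (p.im * s))
            * (Real.exp (p.re * s) * Real.cos (p.im * s))
          - Real.exp (p.re * s) * Real.sin (p.im * s) * (Real.exp (p.re * s) *
            (p.re * Real.cos (p.im * s) - p.im * Real.sin (p.im * s)))
          = p.im * Real.exp (p.re * s) ^ 2 := by
        linear_combination p.im * Real.exp (p.re * s) ^ 2 * h1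
      rw [this]
      exact mul_ne_zero hp (by positivity)

/-- The substitution `s = log x` turns an equation with constant coefficients into a Cauchy–Euler
equation. -/
lemma hasDerivAt_of_eq_comp_log (hIo : IsOpen I) (hIpos : I ⊆ Ioi 0) {F φ φ' : ℝ → ℝ} {A B : ℝ}
    (hF : ∀ x ∈ I, F x = φ (Real.log x)) (hφ : ∀ s, HasDerivAt φ (φ' s) s)
    (hφ' : ∀ s, HasDerivAt φ' (A * φ' s - B * φ s) s) {x : ℝ} (hx : x ∈ I) :
    deriv F x = φ' (Real.log x) / x ∧ HasDerivAt F (deriv F x) x ∧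
      HasDerivAt (deriv F) ((A - 1) / x * deriv F x + -B / x ^ 2 * F x) x := by
  have h1 : ∀ y ∈ I, HasDerivAt F (φ' (Real.log y) / y) y := fun y hy => by
    have hlog := Real.hasDerivAt_log (hIpos hy).ne'
    refine ((hφ _).comp y hlog).congr_of_eventuallyEq ?_
    filter_upwards [hIo.mem_nhds hy] with z hz using hF z hz
  have h2 : deriv F x = φ' (Real.log x) / x := (h1 x hx).deriv
  refine ⟨h2, h2 ▸ h1 x hx, ?_⟩
  have hx0 : x ≠ 0 := (hIpos hx).ne'
  have h3 : HasDerivAt (fun y => φ' (Real.log y) / y)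
      (((A * φ' (Real.log x) - B * φ (Real.log x)) * x⁻¹ * x - φ' (Real.log x) * 1) / x ^ 2) x :=
    ((hφ' _).comp x (Real.hasDerivAt_log hx0)).div (hasDerivAt_id x) hx0
  refine (h3.congr_of_eventuallyEq ?_).congr_deriv ?_
  · filter_upwards [hIo.mem_nhds hx] with z hz using (h1 z hz).deriv
  · rw [h2, hF x hx]
    field_simp
    ring

lemma giniPair_properties (hIo : IsOpen I) (hIpos : I ⊆ Ioi 0) {p q : ℂ}
    (hsum : (p + q).im = 0) (hprod : (p * q).im = 0) :
    (ContDiffOn ℝ 3 (giniF p q) I ∧ ContDiffOn ℝ 3 (giniG p q) I) ∧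
      (∀ x ∈ I, wronski (giniF p q) (giniG p q) x ≠ 0) ∧
      IsLinearSolution I (fun x => ((p + q).re - 1) / x) (fun x => -(p * q).re / x ^ 2)
        (giniF p q) ∧
      IsLinearSolution I (fun x => ((p + q).re - 1) / x) (fun x => -(p * q).re / x ^ 2)
        (giniG p q) := by
  obtain ⟨φ, φ', ψ, ψ', ⟨hφc, hψc⟩, hlog, hd, hW⟩ := exists_giniPair_eq_comp_log hsum hprod
  have hF : ∀ x ∈ I, giniF p q x = φ (Real.log x) := fun x hx => (hlog x (hIpos hx)).1
  have hG : ∀ x ∈ I, giniG p q x = ψ (Real.log x) := fun x hx => (hlog x (hIpos hx)).2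
  have hlc : ContDiffOn ℝ 3 Real.log I :=
    Real.contDiffOn_log.mono fun x hx => (hIpos hx).ne'
  have hdF := fun x (hx : x ∈ I) => hasDerivAt_of_eq_comp_log hIo hIpos hF (fun s => (hd s).1)
    (fun s => (hd s).2.2.1) hx
  have hdG := fun x (hx : x ∈ I) => hasDerivAt_of_eq_comp_log hIo hIpos hG (fun s => (hd s).2.1)
    (fun s => (hd s).2.2.2) hx
  refine ⟨⟨(hφc.comp_contDiffOn hlc).congr hF, (hψc.comp_contDiffOn hlc).congr hG⟩,
    fun x hx => ?_, fun x hx => (hdF x hx).2, fun x hx => (hdG x hx).2⟩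
  rw [wronski, (hdF x hx).1, (hdG x hx).1, hF x hx, hG x hx]
  have : φ' (Real.log x) / x * ψ (Real.log x) - φ (Real.log x) * (ψ' (Real.log x) / x)
      = (φ' (Real.log x) * ψ (Real.log x) - φ (Real.log x) * ψ' (Real.log x)) / x := by ring
  rw [this]
  exact div_ne_zero (hW _) (hIpos hx).ne'

lemma exists_complex_roots (A B : ℝ) : ∃ p q : ℂ, p + q = A ∧ p * q = B := by
  obtain ⟨z, hz⟩ := IsAlgClosed.exists_pow_nat_eq ((A : ℂ) ^ 2 - 4 * B) two_pos
  refine ⟨(A + z) / 2, (A - z) / 2, by ring, ?_⟩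
  linear_combination -hz / 4

end Gini

end GenMeans

open GenMeans in
theorem mainTheorem2 {d : ℕ} {T : Type*} [MeasurableSpace T]
    (μ : MeasureTheory.Measure T) [MeasureTheory.IsProbabilityMeasure μ]
    (I : Set ℝ) (hI_open : IsOpen I) (hI_int : I.OrdConnected) (hI_ne : I.Nonempty)
    (hI_pos : I ⊆ Set.Ioi 0)
    (f g : ℝ → ℝ) (hfg : GenMeans.IsPairC 3 I f g)
    (m : (Fin d → ℝ) → T → ℝ) (hm : GenMeans.IsFamilyC3 μ I m)
    (hm_hom : ∀ t, GenMeans.IsHomogeneousOn I (fun x => m x t))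
    (x₀ : ℝ) (hx₀ : x₀ ∈ I)
    (hnondeg : μ {t | ∀ i, GenMeans.pdStar μ m i (GenMeans.diag d x₀) t = 0} < 1)
    (hthird : ∃ i j l : Fin d,
      ∫ t, GenMeans.pdStar μ m i (GenMeans.diag d x₀) t *
          GenMeans.pdStar μ m j (GenMeans.diag d x₀) t *
          GenMeans.pdStar μ m l (GenMeans.diag d x₀) t ∂μ ≠ 0) :
    List.TFAE [
      -- (i)
      GenMeans.IsHomogeneousOn I (GenMeans.bajMean I f g m μ),
      -- (ii)
      ∀ l ∈ I / I, ∀ x ∈ GenMeans.cube d (GenMeans.scaledInter I l),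
        GenMeans.bajMean I f g m μ x =
          GenMeans.bajMean (GenMeans.scaledInter I l)
            (GenMeans.rescale l f) (GenMeans.rescale l g) m μ x,
      -- (iii)
      ∀ l ∈ I / I, GenMeans.PairsEquivalent (GenMeans.scaledInter I l)
        f g (GenMeans.rescale l f) (GenMeans.rescale l g),
      -- (iv)
      ∀ l ∈ I / I, ∀ x ∈ GenMeans.scaledInter I l,
        GenMeans.PhiFun f g x = GenMeans.PhiFun (GenMeans.rescale l f) (GenMeans.rescale l g) x ∧
        GenMeans.PsiFun f g x = GenMeans.PsiFun (GenMeans.rescale l f) (GenMeans.rescale l g) x,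
      -- (v)
      ∃ α β : ℝ, GenMeans.SolvesCauchyEuler I α β f ∧ GenMeans.SolvesCauchyEuler I α β g,
      -- (vi)
      ∃ p q : ℂ, (p + q).im = 0 ∧ (p * q).im = 0 ∧
        GenMeans.IsChebyshev I (GenMeans.giniF p q) (GenMeans.giniG p q) ∧
        ∀ x ∈ GenMeans.cube d I, GenMeans.bajMean I f g m μ x = GenMeans.giniMean I p q m μ x
    ] := by
  obtain ⟨i₀, j₀, l₀, h3⟩ := hthird
  -- the existence of an index excludes `d = 0`
  have hd : NeZero d := ⟨fun h => (h ▸ i₀).elim0⟩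
  have hmf : IsMeasurableFamily I m := hm.toIsMeasurableFamily
  have hm1 : IsFamilyC1 μ I m := hm.toIsFamilyC1
  have hstar : ∀ y ∈ I, ∀ i t, pdStar μ m i (diag d y) t = pdStar μ m i (diag d x₀) t :=
    fun y hy i t => pdStar_diag_eq_of_homogeneous hI_open hm1 hm_hom hI_pos hx₀ hy i t
  have h12 := isHomogeneousOn_bajMean_iff (μ := μ) hI_open hI_int hI_pos hfg hmf hm_hom
  tfae_have 1 ↔ 2 := h12
  tfae_have 2 → 4 := by
    intro h2 l hl x hx
    have hl0 := pos_of_mem_div hI_pos hl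
    have hJo := isOpen_scaledInter (l := l) hI_open
    have hJ := ordConnected_scaledInter hI_int hl0
    refine PhiFun_PsiFun_eq_of_bajMean_eq hI_open hm1 hJo hJ scaledInter_subset
      (hfg.mono scaledInter_subset) (hfg.rescale hl0.ne') (fun y hy => ?_) (fun y hy => ?_)
      (fun y hy => ?_) hx
    · rw [← h2 l hl y hy]
      exact bajMean_restrict hI_open hI_int hJo hJ scaledInter_subset hfg.chebyshev hmf hy
    · simpa only [hstar y hy.1] using hnondeg
    · exact ⟨i₀, j₀, l₀, by simpa only [hstar y hy.1] using h3⟩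
  tfae_have 4 → 5 := by
    intro h4
    -- rescaling `x₀` to `x` shows that `x Φ(x)` and `x² Ψ(x)` do not depend on `x`
    have hconst : ∀ x ∈ I, PhiFun f g x = x₀ * PhiFun f g x₀ / x ∧
        PsiFun f g x = x₀ ^ 2 * PsiFun f g x₀ / x ^ 2 := by
      intro x hx
      have hx0 : x ≠ 0 := (hI_pos hx).ne'
      have hx00 : x₀ ≠ 0 := (hI_pos hx₀).ne'
      have hmul : x / x₀ * x₀ = x := div_mul_cancel₀ _ hx00
      have h := h4 (x / x₀) (Set.div_mem_div hx hx₀) x₀ ⟨hx₀, by rwa [hmul]⟩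
      rw [PhiFun_rescale (div_ne_zero hx0 hx00), PsiFun_rescale (div_ne_zero hx0 hx00), hmul] at h
      rw [h.1, h.2]
      constructor <;> field_simp
    refine ⟨x₀ * PhiFun f g x₀, x₀ ^ 2 * PsiFun f g x₀, fun x hx => ?_, fun x hx => ?_⟩
    · rw [← (hconst x hx).1, ← (hconst x hx).2]
      exact (deriv_deriv_eq_PhiFun_PsiFun (hfg.wronski_ne_zero x hx)).1
    · rw [← (hconst x hx).1, ← (hconst x hx).2]
      exact (deriv_deriv_eq_PhiFun_PsiFun (hfg.wronski_ne_zero x hx)).2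
  tfae_have 5 → 3 := fun ⟨_, _, hf, hg⟩ _ hl =>
    hfg.pairsEquivalent_rescale hI_open hI_int hI_pos hf hg hl
  tfae_have 3 → 2 := fun h l hl _ hx =>
    bajMean_eq_rescale_of_pairsEquivalent hI_open hI_int hI_pos hfg hmf hl (h l hl) hx
  tfae_have 5 → 6 := by
    rintro ⟨α, β, hf, hg⟩
    -- the exponents are the roots of the indicial equation `r² - (α + 1) r - β = 0`
    obtain ⟨p, q, hsum, hprod⟩ := exists_complex_roots (α + 1) (-β)
    have hsim : (p + q).im = 0 := by rw [hsum, Complex.ofReal_im]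
    have hpim : (p * q).im = 0 := by rw [hprod, Complex.ofReal_im]
    obtain ⟨⟨hFc, hGc⟩, hW, hF, hG⟩ := giniPair_properties hI_open hI_pos hsim hpim
    rw [hsum, hprod, Complex.ofReal_re, Complex.ofReal_re, add_sub_cancel_right, neg_neg] at hF hG
    have hsol := hfg.isLinearSolution hI_open hf hg
    have he := pairsEquivalent_of_isLinearSolution hI_open hI_int hI_ne hfg.chebyshev
      hsol.1 hsol.2 hF hG hW
    exact ⟨p, q, hsim, hpim,
      hfg.chebyshev.of_pairsEquivalent he hFc.continuousOn hGc.continuousOn,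
      fun x hx => bajMean_eq_of_pairsEquivalent hI_int subset_rfl hmf he hx⟩
  tfae_have 6 → 1 := by
    rintro ⟨p, q, hsim, hpim, hcheb, heq⟩
    obtain ⟨⟨hFc, hGc⟩, hW, hF, hG⟩ := giniPair_properties hI_open hI_pos hsim hpim
    have hhom := isHomogeneousOn_bajMean_of_solvesCauchyEuler (μ := μ) hI_open hI_int hI_pos
      ⟨hcheb, hFc, hGc, hW⟩ hmf hm_hom (fun x hx => (hF x hx).2.deriv)
      (fun x hx => (hG x hx).2.deriv)
    intro l hl x hx
    have hlx : l • x ∈ cube d I := fun i => (hx i).2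
    rw [heq _ hlx, heq x fun i => (hx i).1]
    exact hhom l hl x hx
  tfae_finish
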